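/- Let $\mathbb K$ be a field of characteristic $0$. All operads are $\mathbb Z$-graded symmetric operads over $\mathbb K$ (with the Koszul sign rule), $\Gamma(E)$ denotes the free operad on a $\Sigma_3$-module $E$ of ternary operations, $\circ_i$ is the partial composition at the $i$-th input, and $f\cdot\sigma$ denotes the right action, $(f\cdot\sigma)(v_1,\dots,v_m)=f(v_{\sigma^{-1}(1)},\dots,v_{\sigma^{-1}(m)})$. Let $\tau_{13}\in\Sigma_3$ be the transposition of $1$ and $3$. Let $E=\langle\mu\rangle\simeq\mathbb K[\Sigma_3]$ be generated by a ternary operation $\mu$ of degree $0$, and let $\tau_{13}\text{-}\mathcal{A}ss=\Gamma(E)/(R)$ be the quadratic operad of ternary $\tau_{13}$-totally associative algebras, where $R\subset\Gamma(E)(5)$ is the $\mathbb K[\Sigma_5]$-submodule generated by $$\mu\circ_1\mu-\mu\circ_2(\mu\cdot\tau_{13}),\qquad \mu\circ_1\mu-\mu\circ_3\mu .$$ For a quadratic ternary operad $\mathcal P=\Gamma(E)/(R)$ with $E$ finite-dimensional and in degree $0$, put $\overline E=\uparrow E^{\#}\otimes \mathrm{sgn}_3$ (linear dual, tensored with the signature,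 placed in degree $1$), and let $\mathcal P^!=\Gamma(\overline E)/(R^\perp)$, where $R^\perp\subset\Gamma(\overline E)(5)$ is the annihilator of $R$ for the bilinear pairing $\Gamma(\overline E)(5)\times\Gamma(E)(5)\to\mathbb K$ in which trees whose inner vertices carry different sets of inputs are orthogonal and $$\big\langle(\varphi\circ_i\psi)\cdot\rho,\ (e\circ_i f)\cdot\rho\big\rangle=\mathrm{sgn}(\rho)\,\varphi(e)\,\psi(f)\qquad(\varphi,\psi\in\overline E,\ e,f\in E,\ \rho\in\Sigma_5,\ i=1,2,3).$$ Let $\mathcal P=\tau_{13}\text{-}\mathcal{A}ss$ and let $\alpha\in\overline E$ be the ternary operation of degree $1$ given by the linear form on $E$ with $\alpha(\mu)=1$ and $\alpha(\mu\cdot\sigma)=0$ for $\sigma\neq 1$. Then: 1. $R^\perp$ is the $\mathbb K[\Sigma_5]$-submodule of $\Gamma(\overline E)(5)$ generated by $$\alpha\circ_1\alpha-\alpha\circ_2(\alpha\cdot\tau_{13})+\alpha\circ_3\alpha .$$ 2. The dual operad $\mathcal P^!$ is the operad of ternary $\tau_{13}$-partially associative algebras with operation in degree $1$: there is an isomorphism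 of graded operads from $\mathcal P^!$ onto the quotient of the free operad on one ternary operation $\alpha'$ of degree $1$ (generating a copy of $\mathbb K[\Sigma_3]$) by the operadic ideal generated by the $\tau_{13}$-partial associativity relation $\alpha'\circ_1\alpha'-\alpha'\circ_2(\alpha'\cdot\tau_{13})+\alpha'\circ_3\alpha'$, and it sends the class of $\alpha$ to the class of $\alpha'$. -/

import Mathlib

open scoped TensorProduct

noncomputable section

namespace TernaryOperad

universe u v w

/-! ### Symmetric-group modules and graded symmetric operads -/

/-- A right `K[Σ_n]`-module. `act σ x` is `x · σ`. -/
structure SymModule (K : Type u) [Field K] (n : ℕ) where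
  carrier : Type v
  [addCommGroup : AddCommGroup carrier]
  [module : Module K carrier]
  act : Equiv.Perm (Fin n) → carrier →ₗ[K] carrier
  act_one : ∀ x, act 1 x = x
  act_mul : ∀ σ τ x, act (σ * τ) x = act τ (act σ x)

attribute [instance] SymModule.addCommGroup SymModule.module

/-- The Koszul sign `(-1)^{ab}`. -/
def koszulSign (K : Type u) [Field K] (a b : ℤ) : K := if Odd a ∧ Odd b then -1 else 1

/-- Inputs are numbered from `0`. When an operation `y` with `n` inputs is plugged into input `i` of
`x`, the input `j ≠ i` of `x` becomes this input of `x ∘_i y`; the input `l` of `y` becomes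
the input `i + l`. -/
def outerSlot (n i j : ℕ) : ℕ := if j < i then j else j + n - 1

/-- `ρ` is the block permutation `σ ∘_i τ`: it carries the inputs of `(x·σ) ∘_i (y·τ)` to the
corresponding inputs of `x ∘_{σ(i)} y`, where input `j` of `x · σ` is input `σ(j)` of `x`. -/
def IsBlockPerm {m n k : ℕ} (σ : Equiv.Perm (Fin m)) (τ : Equiv.Perm (Fin n)) (i : Fin m)
    (ρ : Equiv.Perm (Fin k)) : Prop :=
  (∀ j : Fin m, j ≠ i → ∀ a : Fin k, (a : ℕ) = outerSlot n i j →
      (ρ a : ℕ) = outerSlot n (σ i) (σ j)) ∧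
    ∀ (l : Fin n) (a : Fin k), (a : ℕ) = i + l → (ρ a : ℕ) = σ i + τ l

/-- A `ℤ`-graded symmetric operad over `K`: `obj n a` is the component of arity `n` and degree `a`,
`act` the right action of the symmetric groups, `comp _ _ i x y` the partial composition `x ∘_i y`
(inputs are numbered from `0`). The equations between arities and degrees are arguments. -/
structure GrOperad (K : Type u) [Field K] where
  obj : ℕ → ℤ → Type v
  [addCommGroup : ∀ n a, AddCommGroup (obj n a)]
  [module : ∀ n a, Module K (obj n a)]
  one : obj 1 0
  act : ∀ {n : ℕ} {a : ℤ}, Equiv.Perm (Fin n) → obj n a →ₗ[K] obj n a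
  comp : ∀ {m n k : ℕ} {a b c : ℤ}, m + n = k + 1 → a + b = c → Fin m →
    obj m a →ₗ[K] obj n b →ₗ[K] obj k c
  act_one : ∀ {n a} (x : obj n a), act 1 x = x
  act_mul : ∀ {n a} (σ τ : Equiv.Perm (Fin n)) (x : obj n a), act (σ * τ) x = act τ (act σ x)
  one_comp : ∀ {n a} (h : 1 + n = n + 1) (h' : 0 + a = a) (i : Fin 1) (x : obj n a),
    comp h h' i one x = x
  comp_one : ∀ {n a} (h : n + 1 = n + 1) (h' : a + 0 = a) (i : Fin n) (x : obj n a),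
    comp h h' i x one = x
  comp_seq : ∀ {m n p s t q : ℕ} {a b c e f g : ℤ}
    (h₁ : m + n = s + 1) (h₁' : a + b = e) (h₂ : s + p = q + 1) (h₂' : e + c = g)
    (h₃ : n + p = t + 1) (h₃' : b + c = f) (h₄ : m + t = q + 1) (h₄' : a + f = g)
    (i : Fin m) (j : Fin n) (r : Fin s) (_ : (r : ℕ) = i + j)
    (x : obj m a) (y : obj n b) (z : obj p c),
    comp h₂ h₂' r (comp h₁ h₁' i x y) z = comp h₄ h₄' i x (comp h₃ h₃' j y z)
  comp_par : ∀ {m n p s t q : ℕ} {a b c e f g : ℤ}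
    (h₁ : m + n = s + 1) (h₁' : a + b = e) (h₂ : s + p = q + 1) (h₂' : e + c = g)
    (h₃ : m + p = t + 1) (h₃' : a + c = f) (h₄ : t + n = q + 1) (h₄' : f + b = g)
    (i j : Fin m) (r : Fin s) (r' : Fin t) (_ : i < j) (_ : (r : ℕ) = outerSlot n i j)
    (_ : (r' : ℕ) = i) (x : obj m a) (y : obj n b) (z : obj p c),
    comp h₂ h₂' r (comp h₁ h₁' i x y) z =
      koszulSign K b c • comp h₄ h₄' r' (comp h₃ h₃' j x z) y
  comp_act : ∀ {m n k : ℕ} {a b c : ℤ} (h : m + n = k + 1) (h' : a + b = c) (i : Fin m)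
    (σ : Equiv.Perm (Fin m)) (τ : Equiv.Perm (Fin n)) (ρ : Equiv.Perm (Fin k))
    (_ : IsBlockPerm σ τ i ρ) (x : obj m a) (y : obj n b),
    comp h h' i (act σ x) (act τ y) = act ρ (comp h h' (σ i) x y)

attribute [instance] GrOperad.addCommGroup GrOperad.module

/-- Morphisms of graded operads (of degree `0`). -/
structure GrOperad.Hom {K : Type u} [Field K] (P : GrOperad.{u, v} K) (Q : GrOperad.{u, w} K) where
  toFun : ∀ {n : ℕ} {a : ℤ}, P.obj n a →ₗ[K] Q.obj n a
  map_one : toFun P.one = Q.one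
  map_act : ∀ {n a} (σ : Equiv.Perm (Fin n)) (x : P.obj n a),
    toFun (P.act σ x) = Q.act σ (toFun x)
  map_comp : ∀ {m n k : ℕ} {a b c : ℤ} (h : m + n = k + 1) (h' : a + b = c) (i : Fin m)
    (x : P.obj m a) (y : P.obj n b),
    toFun (P.comp h h' i x y) = Q.comp h h' i (toFun x) (toFun y)

/-- A morphism is an isomorphism when it is bijective in every arity and degree. -/
def GrOperad.Hom.IsIso {K : Type u} [Field K] {P : GrOperad.{u, v} K} {Q : GrOperad.{u, w} K}
    (f : P.Hom Q) : Prop :=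
  ∀ (n : ℕ) (a : ℤ), Function.Bijective (f.toFun : P.obj n a →ₗ[K] Q.obj n a)

/-! ### The operadic ideal generated by a set, and quotient operads -/

section Quotient

variable {K : Type u} [Field K] (O : GrOperad.{u, v} K)

/-- Membership in the operadic ideal generated by a set `R` of operations of arity `n₀` and
degree `a₀`. -/
inductive IdealMem {n₀ : ℕ} {a₀ : ℤ} (R : Set (O.obj n₀ a₀)) : ∀ n a, O.obj n a → Prop
  | of (x : O.obj n₀ a₀) : x ∈ R → IdealMem R n₀ a₀ x
  | zero (n : ℕ) (a : ℤ) : IdealMem R n a 0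
  | add {n : ℕ} {a : ℤ} (x y : O.obj n a) :
      IdealMem R n a x → IdealMem R n a y → IdealMem R n a (x + y)
  | smul {n : ℕ} {a : ℤ} (c : K) (x : O.obj n a) : IdealMem R n a x → IdealMem R n a (c • x)
  | act {n : ℕ} {a : ℤ} (σ : Equiv.Perm (Fin n)) (x : O.obj n a) :
      IdealMem R n a x → IdealMem R n a (O.act σ x)
  | comp_left {m n k : ℕ} {a b c : ℤ} (h : m + n = k + 1) (h' : a + b = c) (i : Fin m)
      (x : O.obj m a) (y : O.obj n b) : IdealMem R m a x → IdealMem R k c (O.comp h h' i x y)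
  | comp_right {m n k : ℕ} {a b c : ℤ} (h : m + n = k + 1) (h' : a + b = c) (i : Fin m)
      (x : O.obj m a) (y : O.obj n b) : IdealMem R n b y → IdealMem R k c (O.comp h h' i x y)

/-- The arity `n`, degree `a` component of the ideal `(R)`. -/
def ideal {n₀ : ℕ} {a₀ : ℤ} (R : Set (O.obj n₀ a₀)) (n : ℕ) (a : ℤ) : Submodule K (O.obj n a) where
  carrier := {x | IdealMem O R n a x}
  zero_mem' := IdealMem.zero n a
  add_mem' := fun hx hy => IdealMem.add _ _ hx hy
  smul_mem' := fun c _ hx => IdealMem.smul c _ hx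

/-- The quotient operad `O / (R)`. -/
def quotient {n₀ : ℕ} {a₀ : ℤ} (R : Set (O.obj n₀ a₀)) : GrOperad.{u, v} K where
  obj n a := O.obj n a ⧸ ideal O R n a
  one := Submodule.Quotient.mk O.one
  act σ := Submodule.mapQ _ _ (O.act σ) (fun _ hx => IdealMem.act σ _ hx)
  comp {m n k a b c} h h' i :=
    Submodule.liftQ _
      (LinearMap.flip (Submodule.liftQ _
        (LinearMap.flip ((O.comp h h' i).compr₂ (ideal O R k c).mkQ))
        (fun y hy => by
          rw [LinearMap.mem_ker]
          ext x
          simpa using (Submodule.Quotient.mk_eq_zero _).2 (IdealMem.comp_right h h' i x y hy))))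
      (fun x hx => by
        rw [LinearMap.mem_ker]
        ext y
        simpa using (Submodule.Quotient.mk_eq_zero _).2 (IdealMem.comp_left h h' i x y hx))
  act_one x := by
    induction x using Submodule.Quotient.induction_on with
    | H x => exact congrArg Submodule.Quotient.mk (O.act_one x)
  act_mul σ τ x := by
    induction x using Submodule.Quotient.induction_on with
    | H x => exact congrArg Submodule.Quotient.mk (O.act_mul σ τ x)
  one_comp h h' i x := by
    induction x using Submodule.Quotient.induction_on with
    | H x => exact congrArg Submodule.Quotient.mk (O.one_comp h h' i x)
  comp_one h h' i x := by
    induction x using Submodule.Quotient.induction_on with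
    | H x => exact congrArg Submodule.Quotient.mk (O.comp_one h h' i x)
  comp_seq h₁ h₁' h₂ h₂' h₃ h₃' h₄ h₄' i j r hr x y z := by
    induction x using Submodule.Quotient.induction_on with
    | H x =>
    induction y using Submodule.Quotient.induction_on with
    | H y =>
    induction z using Submodule.Quotient.induction_on with
    | H z =>
      exact congrArg Submodule.Quotient.mk
        (O.comp_seq h₁ h₁' h₂ h₂' h₃ h₃' h₄ h₄' i j r hr x y z)
  comp_par h₁ h₁' h₂ h₂' h₃ h₃' h₄ h₄' i j r r' hij hr hr' x y z := by
    induction x using Submodule.Quotient.induction_on with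
    | H x =>
    induction y using Submodule.Quotient.induction_on with
    | H y =>
    induction z using Submodule.Quotient.induction_on with
    | H z =>
      exact congrArg Submodule.Quotient.mk
        (O.comp_par h₁ h₁' h₂ h₂' h₃ h₃' h₄ h₄' i j r r' hij hr hr' x y z)
  comp_act h h' i σ τ ρ hρ x y := by
    induction x using Submodule.Quotient.induction_on with
    | H x =>
    induction y using Submodule.Quotient.induction_on with
    | H y =>
      exact congrArg Submodule.Quotient.mk (O.comp_act h h' i σ τ ρ hρ x y)

/-- The class of an operation in the quotient operad. -/
def quotientMk {n₀ : ℕ} {a₀ : ℤ} (R : Set (O.obj n₀ a₀)) {n : ℕ} {a : ℤ} :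
    O.obj n a →ₗ[K] (quotient O R).obj n a :=
  (ideal O R n a).mkQ

end Quotient

/-! ### The free operad on a ternary `Σ₃`-module placed in one degree -/

section Free

variable {K : Type u} [Field K] (E : SymModule.{u, v} K 3) (d : ℤ)

/-- Formal operadic expressions in ternary generators `e ∈ E` of degree `d`. -/
inductive Term : ℕ → ℤ → Type (max u v)
  | zero (n : ℕ) (a : ℤ) : Term n a
  | add {n : ℕ} {a : ℤ} : Term n a → Term n a → Term n a
  | smul {n : ℕ} {a : ℤ} : K → Term n a → Term n a
  | one : Term 1 0
  | gen : E.carrier → Term 3 d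
  | act {n : ℕ} {a : ℤ} : Equiv.Perm (Fin n) → Term n a → Term n a
  | comp {m n k : ℕ} {a b c : ℤ} : m + n = k + 1 → a + b = c → Fin m →
      Term m a → Term n b → Term k c

/-- The congruence on expressions generated by the axioms of a graded operad and by
linearity and equivariance of the generators. -/
inductive Rel : ∀ {n : ℕ} {a : ℤ}, Term E d n a → Term E d n a → Prop
  -- equivalence relation and congruence
  | refl {n : ℕ} {a : ℤ} (x : Term E d n a) : Rel x x
  | symm {n : ℕ} {a : ℤ} {x y : Term E d n a} : Rel x y → Rel y x
  | trans {n : ℕ} {a : ℤ} {x y z : Term E d n a} : Rel x y → Rel y z → Rel x z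
  | add_congr {n : ℕ} {a : ℤ} {x x' y y' : Term E d n a} :
      Rel x x' → Rel y y' → Rel (.add x y) (.add x' y')
  | smul_congr {n : ℕ} {a : ℤ} (c : K) {x x' : Term E d n a} :
      Rel x x' → Rel (.smul c x) (.smul c x')
  | act_congr {n : ℕ} {a : ℤ} (σ : Equiv.Perm (Fin n)) {x x' : Term E d n a} :
      Rel x x' → Rel (.act σ x) (.act σ x')
  | comp_congr {m n k : ℕ} {a b c : ℤ} (h : m + n = k + 1) (h' : a + b = c) (i : Fin m)
      {x x' : Term E d m a} {y y' : Term E d n b} :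
      Rel x x' → Rel y y' → Rel (.comp h h' i x y) (.comp h h' i x' y')
  -- vector space axioms
  | add_assoc {n : ℕ} {a : ℤ} (x y z : Term E d n a) :
      Rel (.add (.add x y) z) (.add x (.add y z))
  | add_comm {n : ℕ} {a : ℤ} (x y : Term E d n a) : Rel (.add x y) (.add y x)
  | zero_add {n : ℕ} {a : ℤ} (x : Term E d n a) : Rel (.add (.zero n a) x) x
  | neg_add {n : ℕ} {a : ℤ} (x : Term E d n a) : Rel (.add (.smul (-1) x) x) (.zero n a)
  | smul_add {n : ℕ} {a : ℤ} (c : K) (x y : Term E d n a) :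
      Rel (.smul c (.add x y)) (.add (.smul c x) (.smul c y))
  | add_smul {n : ℕ} {a : ℤ} (c c' : K) (x : Term E d n a) :
      Rel (.smul (c + c') x) (.add (.smul c x) (.smul c' x))
  | mul_smul {n : ℕ} {a : ℤ} (c c' : K) (x : Term E d n a) :
      Rel (.smul (c * c') x) (.smul c (.smul c' x))
  | one_smul {n : ℕ} {a : ℤ} (x : Term E d n a) : Rel (.smul 1 x) x
  -- linearity of the operations
  | act_add {n : ℕ} {a : ℤ} (σ : Equiv.Perm (Fin n)) (x y : Term E d n a) :
      Rel (.act σ (.add x y)) (.add (.act σ x) (.act σ y))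
  | act_smul {n : ℕ} {a : ℤ} (σ : Equiv.Perm (Fin n)) (c : K) (x : Term E d n a) :
      Rel (.act σ (.smul c x)) (.smul c (.act σ x))
  | comp_add_left {m n k : ℕ} {a b c : ℤ} (h : m + n = k + 1) (h' : a + b = c) (i : Fin m)
      (x x' : Term E d m a) (y : Term E d n b) :
      Rel (.comp h h' i (.add x x') y) (.add (.comp h h' i x y) (.comp h h' i x' y))
  | comp_smul_left {m n k : ℕ} {a b c : ℤ} (h : m + n = k + 1) (h' : a + b = c) (i : Fin m)
      (s : K) (x : Term E d m a) (y : Term E d n b) :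
      Rel (.comp h h' i (.smul s x) y) (.smul s (.comp h h' i x y))
  | comp_add_right {m n k : ℕ} {a b c : ℤ} (h : m + n = k + 1) (h' : a + b = c) (i : Fin m)
      (x : Term E d m a) (y y' : Term E d n b) :
      Rel (.comp h h' i x (.add y y')) (.add (.comp h h' i x y) (.comp h h' i x y'))
  | comp_smul_right {m n k : ℕ} {a b c : ℤ} (h : m + n = k + 1) (h' : a + b = c) (i : Fin m)
      (s : K) (x : Term E d m a) (y : Term E d n b) :
      Rel (.comp h h' i x (.smul s y)) (.smul s (.comp h h' i x y))
  -- linearity and equivariance of the generators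
  | gen_add (e f : E.carrier) : Rel (.gen (e + f)) (.add (.gen e) (.gen f))
  | gen_smul (c : K) (e : E.carrier) : Rel (.gen (c • e)) (.smul c (.gen e))
  | gen_act (σ : Equiv.Perm (Fin 3)) (e : E.carrier) : Rel (.gen (E.act σ e)) (.act σ (.gen e))
  -- operad axioms
  | act_one {n : ℕ} {a : ℤ} (x : Term E d n a) : Rel (.act 1 x) x
  | act_mul {n : ℕ} {a : ℤ} (σ τ : Equiv.Perm (Fin n)) (x : Term E d n a) :
      Rel (.act (σ * τ) x) (.act τ (.act σ x))
  | one_comp {n : ℕ} {a : ℤ} (h : 1 + n = n + 1) (h' : 0 + a = a) (i : Fin 1)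
      (x : Term E d n a) : Rel (.comp h h' i .one x) x
  | comp_one {n : ℕ} {a : ℤ} (h : n + 1 = n + 1) (h' : a + 0 = a) (i : Fin n)
      (x : Term E d n a) : Rel (.comp h h' i x .one) x
  | comp_seq {m n p s t q : ℕ} {a b c e f g : ℤ}
      (h₁ : m + n = s + 1) (h₁' : a + b = e) (h₂ : s + p = q + 1) (h₂' : e + c = g)
      (h₃ : n + p = t + 1) (h₃' : b + c = f) (h₄ : m + t = q + 1) (h₄' : a + f = g)
      (i : Fin m) (j : Fin n) (r : Fin s) (hr : (r : ℕ) = i + j)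
      (x : Term E d m a) (y : Term E d n b) (z : Term E d p c) :
      Rel (.comp h₂ h₂' r (.comp h₁ h₁' i x y) z) (.comp h₄ h₄' i x (.comp h₃ h₃' j y z))
  | comp_par {m n p s t q : ℕ} {a b c e f g : ℤ}
      (h₁ : m + n = s + 1) (h₁' : a + b = e) (h₂ : s + p = q + 1) (h₂' : e + c = g)
      (h₃ : m + p = t + 1) (h₃' : a + c = f) (h₄ : t + n = q + 1) (h₄' : f + b = g)
      (i j : Fin m) (r : Fin s) (r' : Fin t) (hij : i < j) (hr : (r : ℕ) = outerSlot n i j)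
      (hr' : (r' : ℕ) = i) (x : Term E d m a) (y : Term E d n b) (z : Term E d p c) :
      Rel (.comp h₂ h₂' r (.comp h₁ h₁' i x y) z)
        (.smul (koszulSign K b c) (.comp h₄ h₄' r' (.comp h₃ h₃' j x z) y))
  | comp_act {m n k : ℕ} {a b c : ℤ} (h : m + n = k + 1) (h' : a + b = c) (i : Fin m)
      (σ : Equiv.Perm (Fin m)) (τ : Equiv.Perm (Fin n)) (ρ : Equiv.Perm (Fin k))
      (hρ : IsBlockPerm σ τ i ρ) (x : Term E d m a) (y : Term E d n b) :
      Rel (.comp h h' i (.act σ x) (.act τ y)) (.act ρ (.comp h h' (σ i) x y))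

/-- The component of arity `n` and degree `a` of the free operad `Γ(E)`. -/
def FreeObj (n : ℕ) (a : ℤ) : Type (max u v) := Quot (Rel E d (n := n) (a := a))

namespace FreeObj

variable {E d}

/-- The class of an expression. -/
def mk {n : ℕ} {a : ℤ} (x : Term E d n a) : FreeObj E d n a := Quot.mk _ x

variable {n : ℕ} {a : ℤ}

instance : Zero (FreeObj E d n a) := ⟨mk (.zero n a)⟩

instance : Add (FreeObj E d n a) :=
  ⟨Quot.map₂ .add (fun x _ _ h => .add_congr (.refl x) h) (fun _ _ y h => .add_congr h (.refl y))⟩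

instance : SMul K (FreeObj E d n a) := ⟨fun c => Quot.map (.smul c) (fun _ _ h => .smul_congr c h)⟩

instance : Neg (FreeObj E d n a) := ⟨fun x => (-1 : K) • x⟩

theorem zero_add' (x : FreeObj E d n a) : 0 + x = x := by
  rcases x with ⟨x⟩
  exact Quot.sound (.zero_add x)

theorem add_comm' (x y : FreeObj E d n a) : x + y = y + x := by
  rcases x with ⟨x⟩
  rcases y with ⟨y⟩
  exact Quot.sound (.add_comm x y)

theorem neg_add' (x : FreeObj E d n a) : -x + x = 0 := by
  rcases x with ⟨x⟩
  exact Quot.sound (.neg_add x)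

instance : AddCommGroup (FreeObj E d n a) where
  add_assoc := by
    rintro ⟨x⟩ ⟨y⟩ ⟨z⟩
    exact Quot.sound (.add_assoc x y z)
  zero_add := zero_add'
  add_zero x := by rw [add_comm', zero_add']
  add_comm := add_comm'
  neg_add_cancel := neg_add'
  nsmul := nsmulRec
  zsmul := zsmulRec

theorem smul_add' (c : K) (x y : FreeObj E d n a) : c • (x + y) = c • x + c • y := by
  rcases x with ⟨x⟩
  rcases y with ⟨y⟩
  exact Quot.sound (.smul_add c x y)

theorem add_smul' (c c' : K) (x : FreeObj E d n a) : (c + c') • x = c • x + c' • x := by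
  rcases x with ⟨x⟩
  exact Quot.sound (.add_smul c c' x)

instance : Module K (FreeObj E d n a) where
  one_smul := by
    rintro ⟨x⟩
    exact Quot.sound (.one_smul x)
  mul_smul := by
    rintro c c' ⟨x⟩
    exact Quot.sound (.mul_smul c c' x)
  smul_add := smul_add'
  add_smul := add_smul'
  smul_zero c := by
    have h := smul_add' c (0 : FreeObj E d n a) 0
    rw [add_zero] at h
    exact left_eq_add.1 h
  zero_smul x := by
    have h := add_smul' 0 0 x
    rw [add_zero] at h
    exact left_eq_add.1 h

/-- The action of the symmetric group. -/
def actHom (σ : Equiv.Perm (Fin n)) : FreeObj E d n a →ₗ[K] FreeObj E d n a where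
  toFun := Quot.map (.act σ) (fun _ _ h => .act_congr σ h)
  map_add' := by
    rintro ⟨x⟩ ⟨y⟩
    exact Quot.sound (.act_add σ x y)
  map_smul' := by
    rintro c ⟨x⟩
    exact Quot.sound (.act_smul σ c x)

/-- The partial compositions. -/
def compHom {m n k : ℕ} {a b c : ℤ} (h : m + n = k + 1) (h' : a + b = c) (i : Fin m) :
    FreeObj E d m a →ₗ[K] FreeObj E d n b →ₗ[K] FreeObj E d k c :=
  LinearMap.mk₂ K
    (Quot.map₂ (.comp h h' i) (fun x _ _ r => .comp_congr h h' i (.refl x) r)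
      (fun _ _ y r => .comp_congr h h' i r (.refl y)))
    (by
      rintro ⟨x⟩ ⟨x'⟩ ⟨y⟩
      exact Quot.sound (.comp_add_left h h' i x x' y))
    (by
      rintro s ⟨x⟩ ⟨y⟩
      exact Quot.sound (.comp_smul_left h h' i s x y))
    (by
      rintro ⟨x⟩ ⟨y⟩ ⟨y'⟩
      exact Quot.sound (.comp_add_right h h' i x y y'))
    (by
      rintro s ⟨x⟩ ⟨y⟩
      exact Quot.sound (.comp_smul_right h h' i s x y))

end FreeObj

/-- The free graded operad `Γ(E)` on the `Σ₃`-module `E` of ternary operations of degree `d`. -/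
def free : GrOperad.{u, max u v} K where
  obj n a := FreeObj E d n a
  one := FreeObj.mk .one
  act := FreeObj.actHom
  comp := FreeObj.compHom
  act_one := by
    rintro n a ⟨x⟩
    exact Quot.sound (.act_one x)
  act_mul := by
    rintro n a σ τ ⟨x⟩
    exact Quot.sound (.act_mul σ τ x)
  one_comp := by
    rintro n a h h' i ⟨x⟩
    exact Quot.sound (.one_comp h h' i x)
  comp_one := by
    rintro n a h h' i ⟨x⟩
    exact Quot.sound (.comp_one h h' i x)
  comp_seq := by
    rintro m n p s t q a b c e f g h₁ h₁' h₂ h₂' h₃ h₃' h₄ h₄' i j r hr ⟨x⟩ ⟨y⟩ ⟨z⟩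
    exact Quot.sound (.comp_seq h₁ h₁' h₂ h₂' h₃ h₃' h₄ h₄' i j r hr x y z)
  comp_par := by
    rintro m n p s t q a b c e f g h₁ h₁' h₂ h₂' h₃ h₃' h₄ h₄' i j r r' hij hr hr' ⟨x⟩ ⟨y⟩ ⟨z⟩
    exact Quot.sound (.comp_par h₁ h₁' h₂ h₂' h₃ h₃' h₄ h₄' i j r r' hij hr hr' x y z)
  comp_act := by
    rintro m n k a b c h h' i σ τ ρ hρ ⟨x⟩ ⟨y⟩
    exact Quot.sound (.comp_act h h' i σ τ ρ hρ x y)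

/-- The inclusion of the generators `E → Γ(E)(3)_d`. -/
def freeGen : E.carrier →ₗ[K] (free E d).obj 3 d where
  toFun e := FreeObj.mk (.gen e)
  map_add' e f := Quot.sound (.gen_add e f)
  map_smul' c e := Quot.sound (.gen_smul c e)

section Lift

variable {E d} (Q : GrOperad.{u, w} K) (φ : E.carrier →ₗ[K] Q.obj 3 d)

/-- Evaluation of expressions in an operad. -/
def Term.eval : ∀ {n : ℕ} {a : ℤ}, Term E d n a → Q.obj n a
  | _, _, .zero _ _ => 0
  | _, _, .add x y => x.eval + y.eval
  | _, _, .smul c x => c • x.eval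
  | _, _, .one => Q.one
  | _, _, .gen e => φ e
  | _, _, .act σ x => Q.act σ x.eval
  | _, _, .comp h h' i x y => Q.comp h h' i x.eval y.eval

theorem Rel.eval_eq (hφ : ∀ σ e, φ (E.act σ e) = Q.act σ (φ e)) {n : ℕ} {a : ℤ}
    {x y : Term E d n a} (h : Rel E d x y) : x.eval Q φ = y.eval Q φ := by
  induction h with
  | refl x => rfl
  | symm _ ih => exact ih.symm
  | trans _ _ ih ih' => exact ih.trans ih'
  | add_congr _ _ ih ih' => simp only [Term.eval, ih, ih']
  | smul_congr c _ ih => simp only [Term.eval, ih]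
  | act_congr σ _ ih => simp only [Term.eval, ih]
  | comp_congr h h' i _ _ ih ih' => simp only [Term.eval, ih, ih']
  | add_assoc x y z => exact _root_.add_assoc _ _ _
  | add_comm x y => exact _root_.add_comm _ _
  | zero_add x => exact _root_.zero_add _
  | neg_add x => simp [Term.eval]
  | smul_add c x y => exact _root_.smul_add _ _ _
  | add_smul c c' x => exact _root_.add_smul _ _ _
  | mul_smul c c' x => exact SemigroupAction.mul_smul _ _ _
  | one_smul x => exact _root_.one_smul _ _
  | act_add σ x y => simp [Term.eval]
  | act_smul σ c x => simp [Term.eval]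
  | comp_add_left h h' i x x' y => simp [Term.eval]
  | comp_smul_left h h' i s x y => simp [Term.eval]
  | comp_add_right h h' i x y y' => simp [Term.eval]
  | comp_smul_right h h' i s x y => simp [Term.eval]
  | gen_add e f => simp [Term.eval]
  | gen_smul c e => simp [Term.eval]
  | gen_act σ e => exact hφ σ e
  | act_one x => exact Q.act_one _
  | act_mul σ τ x => exact Q.act_mul _ _ _
  | one_comp h h' i x => exact Q.one_comp h h' i _
  | comp_one h h' i x => exact Q.comp_one h h' i _
  | comp_seq h₁ h₁' h₂ h₂' h₃ h₃' h₄ h₄' i j r hr x y z =>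
    exact Q.comp_seq h₁ h₁' h₂ h₂' h₃ h₃' h₄ h₄' i j r hr _ _ _
  | comp_par h₁ h₁' h₂ h₂' h₃ h₃' h₄ h₄' i j r r' hij hr hr' x y z =>
    exact Q.comp_par h₁ h₁' h₂ h₂' h₃ h₃' h₄ h₄' i j r r' hij hr hr' _ _ _
  | comp_act h h' i σ τ ρ hρ x y => exact Q.comp_act h h' i σ τ ρ hρ _ _

/-- The universal property of `Γ(E)`: an equivariant linear map `E → Q(3)_d` extends to a morphism
of operads. -/
def freeLift (hφ : ∀ σ e, φ (E.act σ e) = Q.act σ (φ e)) : (free E d).Hom Q where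
  toFun {n a} :=
    { toFun := fun x => Quot.lift (fun t : Term E d n a => t.eval Q φ)
        (fun _ _ h => Rel.eval_eq Q φ hφ h) x
      map_add' := by
        rintro ⟨x⟩ ⟨y⟩
        rfl
      map_smul' := by
        rintro c ⟨x⟩
        rfl }
  map_one := rfl
  map_act := by
    rintro n a σ ⟨x⟩
    rfl
  map_comp := by
    rintro m n k a b c h h' i ⟨x⟩ ⟨y⟩
    rfl

end Lift

end Free

/-! ### The pairing between `Γ(E)(5)` and `Γ(E^# ⊗ sgn)(5)` -/

section Truncation

variable {K : Type u} [Field K] (E : SymModule.{u, v} K 3) (d : ℤ)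

open Classical in
/-- The coefficients of the two-vertex tree `e ∘_i f`: to `ν ∈ Σ₅` is assigned the sum of
`(e·σ) ⊗ (f·τ)` over the pairs `σ, τ ∈ Σ₃` with `e ∘_i f = ((e·σ) ∘_0 (f·τ)) · ν`. Each of the twelve
ways of writing the tree `e ∘_i f` with its inner vertex in the first input occurs once. -/
def treeCoeff (i : ℕ) : E.carrier →ₗ[K] E.carrier →ₗ[K]
    (Equiv.Perm (Fin 5) → E.carrier ⊗[K] E.carrier) :=
  LinearMap.mk₂ K
    (fun e f ν => ∑ σ : Equiv.Perm (Fin 3), ∑ τ : Equiv.Perm (Fin 3),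
      if (σ 0 : ℕ) = i ∧ IsBlockPerm σ τ 0 ν⁻¹ then E.act σ e ⊗ₜ[K] E.act τ f else 0)
    (by
      intro e e' f
      funext ν
      simp only [Pi.add_apply, ← Finset.sum_add_distrib]
      refine Finset.sum_congr rfl fun σ _ => Finset.sum_congr rfl fun τ _ => ?_
      split_ifs <;> simp [TensorProduct.add_tmul])
    (by
      intro c e f
      funext ν
      simp only [Pi.smul_apply, Finset.smul_sum]
      refine Finset.sum_congr rfl fun σ _ => Finset.sum_congr rfl fun τ _ => ?_
      split_ifs <;> simp [TensorProduct.smul_tmul'])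
    (by
      intro e f f'
      funext ν
      simp only [Pi.add_apply, ← Finset.sum_add_distrib]
      refine Finset.sum_congr rfl fun σ _ => Finset.sum_congr rfl fun τ _ => ?_
      split_ifs <;> simp [TensorProduct.tmul_add])
    (by
      intro c e f
      funext ν
      simp only [Pi.smul_apply, Finset.smul_sum]
      refine Finset.sum_congr rfl fun σ _ => Finset.sum_congr rfl fun τ _ => ?_
      split_ifs <;> simp)

/-- A permutation of `Fin n`, seen as a permutation of `Fin k` when `n = k`. -/
def castPerm (k : ℕ) {n : ℕ} (σ : Equiv.Perm (Fin n)) : Equiv.Perm (Fin k) :=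
  if h : n = k then (finCongr h).permCongr σ else 1

theorem castPerm_self {k : ℕ} (σ : Equiv.Perm (Fin k)) : castPerm k σ = σ := by
  ext x
  simp [castPerm]

theorem castPerm_one (k n : ℕ) : castPerm k (1 : Equiv.Perm (Fin n)) = 1 := by
  by_cases h : n = k
  · subst h
    exact castPerm_self _
  · simp [castPerm, h]

theorem castPerm_mul (k : ℕ) {n : ℕ} (σ τ : Equiv.Perm (Fin n)) :
    castPerm k (σ * τ) = castPerm k σ * castPerm k τ := by
  by_cases h : n = k
  · subst h
    simp only [castPerm_self]
  · simp [castPerm, h]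

/-- Triples of coefficients: of the identity, of the one-vertex trees, of the two-vertex trees. -/
abbrev TruncCarrier : Type (max u v) :=
  K × E.carrier × (Equiv.Perm (Fin 5) → E.carrier ⊗[K] E.carrier)

/-- The component of arity `n` and degree `a`: the identity has arity `1` and degree `0`, one-vertex
trees have arity `3` and degree `d`, two-vertex trees have arity `5` and degree `d + d`. -/
def truncObj (n : ℕ) (a : ℤ) : Submodule K (TruncCarrier E) where
  carrier := {x | (x.1 ≠ 0 → n = 1 ∧ a = 0) ∧ (x.2.1 ≠ 0 → n = 3 ∧ a = d) ∧
    (x.2.2 ≠ 0 → n = 5 ∧ a = d + d)}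
  zero_mem' := by simp
  add_mem' := by
    rintro x y ⟨h₁, h₂, h₃⟩ ⟨h₁', h₂', h₃'⟩
    refine ⟨fun h => ?_, fun h => ?_, fun h => ?_⟩
    · by_cases hx : x.1 = 0
      · exact h₁' fun hy => h (by simp [hx, hy])
      · exact h₁ hx
    · by_cases hx : x.2.1 = 0
      · exact h₂' fun hy => h (by simp [hx, hy])
      · exact h₂ hx
    · by_cases hx : x.2.2 = 0
      · exact h₃' fun hy => h (by simp [hx, hy])
      · exact h₃ hx
  smul_mem' := by
    rintro c x ⟨h₁, h₂, h₃⟩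
    refine ⟨fun h => h₁ fun h' => h ?_, fun h => h₂ fun h' => h ?_, fun h => h₃ fun h' => h ?_⟩ <;>
      simp [h']

/-- `ρ ∈ Σ_n` acts on the coefficients of one-vertex trees through `E`, on those of two-vertex trees by
translation. -/
def truncAct {n : ℕ} (ρ : Equiv.Perm (Fin n)) : TruncCarrier E →ₗ[K] TruncCarrier E where
  toFun x := (x.1, E.act (castPerm 3 ρ) x.2.1, fun ν => x.2.2 (ν * (castPerm 5 ρ)⁻¹))
  map_add' x y := by
    ext <;> simp
  map_smul' c x := by
    ext <;> simp

/-- Partial composition, all trees with at least three vertices being set to `0`. -/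
def truncComp (i : ℕ) : TruncCarrier E →ₗ[K] TruncCarrier E →ₗ[K] TruncCarrier E :=
  LinearMap.mk₂ K
    (fun x y => (x.1 * y.1, x.1 • y.2.1 + y.1 • x.2.1,
      x.1 • y.2.2 + y.1 • x.2.2 + treeCoeff E i x.2.1 y.2.1))
    (by
      intro x x' y
      refine Prod.ext ?_ (Prod.ext ?_ ?_)
      · simp [add_mul]
      · simp only [Prod.fst_add, Prod.snd_add, add_smul, smul_add]
        abel
      · simp only [Prod.fst_add, Prod.snd_add, add_smul, smul_add, map_add, LinearMap.add_apply]
        abel)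
    (by
      intro c x y
      refine Prod.ext ?_ (Prod.ext ?_ ?_)
      · simp [mul_assoc]
      · simp [mul_smul, smul_comm c]
      · simp [mul_smul, smul_comm c])
    (by
      intro x y y'
      refine Prod.ext ?_ (Prod.ext ?_ ?_)
      · simp [mul_add]
      · simp only [Prod.fst_add, Prod.snd_add, add_smul, smul_add]
        abel
      · simp only [Prod.fst_add, Prod.snd_add, add_smul, smul_add, map_add]
        abel)
    (by
      intro c x y
      refine Prod.ext ?_ (Prod.ext ?_ ?_)
      · simp [mul_left_comm]
      · simp [mul_smul, smul_comm c]
      · simp [mul_smul, smul_comm c])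

variable {E d}

theorem truncComp_apply (i : ℕ) (x y : TruncCarrier E) :
    truncComp E i x y = (x.1 * y.1, x.1 • y.2.1 + y.1 • x.2.1,
      x.1 • y.2.2 + y.1 • x.2.2 + treeCoeff E i x.2.1 y.2.1) := rfl

theorem truncComp_mem {m n k : ℕ} {a b c : ℤ} (h : m + n = k + 1) (h' : a + b = c) (i : ℕ)
    {x y : TruncCarrier E} (hx : x ∈ truncObj E d m a) (hy : y ∈ truncObj E d n b) :
    truncComp E i x y ∈ truncObj E d k c := by
  obtain ⟨h₁, h₂, h₃⟩ := hx
  obtain ⟨h₁', h₂', h₃'⟩ := hy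
  rw [truncComp_apply]
  refine ⟨fun hz => ?_, fun hz => ?_, fun hz => ?_⟩
  · have := h₁ (left_ne_zero_of_mul hz)
    have := h₁' (right_ne_zero_of_mul hz)
    omega
  · dsimp only at hz
    by_cases h0 : x.1 • y.2.1 = 0
    · rw [h0, zero_add] at hz
      have := h₁' (left_ne_zero_of_smul hz)
      have := h₂ (right_ne_zero_of_smul hz)
      omega
    · have := h₁ (left_ne_zero_of_smul h0)
      have := h₂' (right_ne_zero_of_smul h0)
      omega
  · dsimp only at hz
    by_cases h0 : x.1 • y.2.2 = 0
    · by_cases h1 : y.1 • x.2.2 = 0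
      · rw [h0, h1, zero_add, zero_add] at hz
        have := h₂ (fun hh => hz (by rw [hh]; simp))
        have := h₂' (fun hh => hz (by rw [hh]; simp))
        omega
      · have := h₁' (left_ne_zero_of_smul h1)
        have := h₃ (right_ne_zero_of_smul h1)
        omega
    · have := h₁ (left_ne_zero_of_smul h0)
      have := h₃' (right_ne_zero_of_smul h0)
      omega

theorem truncAct_mem {n : ℕ} {a : ℤ} (ρ : Equiv.Perm (Fin n)) {x : TruncCarrier E}
    (hx : x ∈ truncObj E d n a) : truncAct E ρ x ∈ truncObj E d n a := by
  obtain ⟨h₁, h₂, h₃⟩ := hx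
  refine ⟨h₁, fun h => h₂ fun hh => h ?_, fun h => h₃ fun hh => h ?_⟩
  · simp [truncAct, hh]
  · funext ν
    simp [truncAct, hh]

theorem IsBlockPerm.mul {m n k : ℕ} {σ σ' : Equiv.Perm (Fin m)} {τ τ' : Equiv.Perm (Fin n)}
    {i i' : Fin m} {ρ ρ' : Equiv.Perm (Fin k)} (h : IsBlockPerm σ τ i ρ)
    (h' : IsBlockPerm σ' τ' i' ρ') (hi : σ' i' = i) :
    IsBlockPerm (σ * σ') (τ * τ') i' (ρ * ρ') := by
  subst hi
  refine ⟨fun j hj a ha => ?_, fun l a ha => ?_⟩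
  · exact h.1 (σ' j) (fun e => hj (σ'.injective e)) (ρ' a) (h'.1 j hj a ha)
  · exact h.2 (τ' l) (ρ' a) (h'.2 l a ha)

theorem IsBlockPerm.inv {m n k : ℕ} (hk : m + n = k + 1) {σ : Equiv.Perm (Fin m)}
    {τ : Equiv.Perm (Fin n)} {i : Fin m} {ρ : Equiv.Perm (Fin k)} (h : IsBlockPerm σ τ i ρ) :
    IsBlockPerm σ⁻¹ τ⁻¹ (σ i) ρ⁻¹ := by
  have hi := i.isLt
  refine ⟨fun j hj a ha => ?_, fun l a ha => ?_⟩
  · have hne : σ⁻¹ j ≠ i := fun e => hj (by rw [← e]; simp)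
    have hne' : ((σ⁻¹ j : Fin m) : ℕ) ≠ i := fun e => hne (Fin.ext e)
    have hb := (σ⁻¹ j).isLt
    have hlt : outerSlot n i (σ⁻¹ j : Fin m) < k := by
      unfold outerSlot
      split_ifs <;> omega
    have h2 := h.1 (σ⁻¹ j) hne ⟨_, hlt⟩ rfl
    have h3 : ρ ⟨_, hlt⟩ = a := Fin.ext (by rw [h2, ha]; simp)
    rw [← h3]
    simp
  · have hb := (τ⁻¹ l).isLt
    have hlt : (i : ℕ) + (τ⁻¹ l : Fin n) < k := by omega
    have h2 := h.2 (τ⁻¹ l) ⟨_, hlt⟩ rfl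
    have h3 : ρ ⟨_, hlt⟩ = a := Fin.ext (by rw [h2, ha]; simp)
    rw [← h3]
    simp

theorem treeCoeff_act (i : Fin 3) {σ τ : Equiv.Perm (Fin 3)} {ρ : Equiv.Perm (Fin 5)}
    (h : IsBlockPerm σ τ i ρ) (e f : E.carrier) (ν : Equiv.Perm (Fin 5)) :
    treeCoeff E i (E.act σ e) (E.act τ f) ν = treeCoeff E (σ i : ℕ) e f (ν * ρ⁻¹) := by
  classical
  simp only [treeCoeff, LinearMap.mk₂_apply]
  refine Fintype.sum_equiv (Equiv.mulLeft σ) _ _ fun σ' => ?_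
  refine Fintype.sum_equiv (Equiv.mulLeft τ) _ _ fun τ' => ?_
  simp only [Equiv.coe_mulLeft, ← E.act_mul]
  refine if_congr ?_ rfl rfl
  rw [mul_inv_rev, inv_inv]
  constructor
  · rintro ⟨h1, h2⟩
    have h1' : σ' 0 = i := Fin.ext h1
    exact ⟨by simp [h1'], h.mul h2 h1'⟩
  · rintro ⟨h1, h2⟩
    have h1' : σ' 0 = i := σ.injective (Fin.ext h1)
    refine ⟨by rw [h1'], ?_⟩
    have hinv : IsBlockPerm σ⁻¹ τ⁻¹ (σ i) ρ⁻¹ := h.inv (by norm_num)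
    have h3 := hinv.mul h2 (by simp [h1'])
    simpa [← mul_assoc] using h3

/-- In arity `1` (on either side) a block permutation is the obvious one. -/
theorem IsBlockPerm.eq_right {n : ℕ} {σ : Equiv.Perm (Fin 1)} {τ ρ : Equiv.Perm (Fin n)} {i : Fin 1}
    (h : IsBlockPerm σ τ i ρ) : ρ = τ := by
  ext a
  have := h.2 a a (by simp)
  simpa using this

theorem IsBlockPerm.eq_left {m : ℕ} {σ ρ : Equiv.Perm (Fin m)} {τ : Equiv.Perm (Fin 1)} {i : Fin m}
    (h : IsBlockPerm σ τ i ρ) : ρ = σ := by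
  have key : ∀ j k : ℕ, outerSlot 1 j k = k := by
    intro j k
    simp [outerSlot]
  ext a
  by_cases ha : a = i
  · subst ha
    simpa using h.2 0 a (by simp)
  · simpa [key] using h.1 a ha a (by simp [key])

variable (E d)

/-- The quotient of `Γ(E)` by all trees with at least three vertices, in coordinates. -/
def truncFree : GrOperad.{u, max u v} K where
  obj n a := truncObj E d n a
  one := ⟨(1, 0, 0), by simp [truncObj]⟩
  act ρ := (truncAct E ρ).restrict fun _ hx => truncAct_mem ρ hx
  comp h h' i := LinearMap.mk₂ K
    (fun x y => ⟨truncComp E i x y, truncComp_mem h h' i x.2 y.2⟩)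
    (fun x x' y => Subtype.ext (by simp))
    (fun c x y => Subtype.ext (by simp))
    (fun x y y' => Subtype.ext (by simp))
    (fun c x y => Subtype.ext (by simp))
  act_one x := by
    refine Subtype.ext (Prod.ext rfl (Prod.ext ?_ ?_))
    · simp [truncAct, castPerm_one, E.act_one]
    · simp [truncAct, castPerm_one]
  act_mul σ τ x := by
    refine Subtype.ext (Prod.ext rfl (Prod.ext ?_ ?_))
    · simp [truncAct, castPerm_mul, E.act_mul]
    · simp [truncAct, castPerm_mul, mul_assoc]
  one_comp h h' i x := Subtype.ext (by simp [truncComp_apply])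
  comp_one h h' i x := Subtype.ext (by simp [truncComp_apply])
  comp_seq := by
    rintro m n p s t q a b c e f g h₁ h₁' h₂ h₂' h₃ h₃' h₄ h₄' i j r hr
      ⟨x, hx⟩ ⟨y, hy⟩ ⟨z, hz⟩
    refine Subtype.ext ?_
    simp only [LinearMap.mk₂_apply, truncComp_apply, hr]
    refine Prod.ext ?_ (Prod.ext ?_ ?_)
    · exact mul_assoc _ _ _
    · simp only [smul_add, smul_smul, mul_comm z.1]
      abel
    · have e1 : x.1 • treeCoeff E (i + j) y.2.1 z.2.1 = x.1 • treeCoeff E j y.2.1 z.2.1 := by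
        by_cases h0 : x.1 = 0
        · simp [h0]
        · obtain ⟨rfl, -⟩ := hx.1 h0
          simp
      have e2 : y.1 • treeCoeff E (i + j) x.2.1 z.2.1 = y.1 • treeCoeff E i x.2.1 z.2.1 := by
        by_cases h0 : y.1 = 0
        · simp [h0]
        · obtain ⟨rfl, -⟩ := hy.1 h0
          simp
      simp only [smul_add, smul_smul, map_add, map_smul, LinearMap.add_apply,
        LinearMap.smul_apply, e1, e2, mul_comm z.1]
      abel
  comp_par := by
    rintro m n p s t q a b c e f g h₁ h₁' h₂ h₂' h₃ h₃' h₄ h₄' i j r r' hij hr hr'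
      ⟨x, hx⟩ ⟨y, hy⟩ ⟨z, hz⟩
    refine Subtype.ext ?_
    have hx0 : x.1 = 0 := by
      by_contra h0
      obtain ⟨rfl, -⟩ := hx.1 h0
      omega
    have e2 : y.1 • treeCoeff E r x.2.1 z.2.1 = y.1 • treeCoeff E j x.2.1 z.2.1 := by
      by_cases h0 : y.1 = 0
      · simp [h0]
      · obtain ⟨rfl, -⟩ := hy.1 h0
        simp [hr, outerSlot]
    have hs : (y.1 = 0 ∧ z.1 = 0) ∨ koszulSign K b c = 1 := by
      by_cases h0 : y.1 = 0
      · by_cases h0' : z.1 = 0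
        · exact Or.inl ⟨h0, h0'⟩
        · obtain ⟨-, rfl⟩ := hz.1 h0'
          exact Or.inr (by simp [koszulSign])
      · obtain ⟨-, rfl⟩ := hy.1 h0
        exact Or.inr (by simp [koszulSign])
    simp only [LinearMap.mk₂_apply, truncComp_apply, Submodule.coe_smul, hx0, hr']
    rcases hs with ⟨hy0, hz0⟩ | hs
    · simp [hy0, hz0]
    · rw [hs, one_smul]
      refine Prod.ext ?_ (Prod.ext ?_ ?_)
      · simp
      · simp only [zero_mul, zero_smul, zero_add, smul_smul, mul_comm z.1]
      · simp only [zero_mul, zero_smul, zero_add, smul_add, smul_smul, map_smul,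
          LinearMap.smul_apply, e2, mul_comm z.1]
        abel
  comp_act := by
    rintro m n k a b c h h' i σ τ ρ hρ ⟨x, hx⟩ ⟨y, hy⟩
    refine Subtype.ext ?_
    simp only [LinearMap.mk₂_apply, truncComp_apply, LinearMap.coe_restrict_apply, truncAct,
      LinearMap.coe_mk, AddHom.coe_mk]
    refine Prod.ext rfl (Prod.ext ?_ ?_)
    · have e1 : x.1 • E.act (castPerm 3 τ) y.2.1 = x.1 • E.act (castPerm 3 ρ) y.2.1 := by
        by_cases h0 : x.1 = 0
        · simp [h0]
        · obtain ⟨rfl, -⟩ := hx.1 h0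
          obtain rfl : n = k := by omega
          rw [hρ.eq_right]
      have e2 : y.1 • E.act (castPerm 3 σ) x.2.1 = y.1 • E.act (castPerm 3 ρ) x.2.1 := by
        by_cases h0 : y.1 = 0
        · simp [h0]
        · obtain ⟨rfl, -⟩ := hy.1 h0
          obtain rfl : m = k := by omega
          rw [hρ.eq_left]
      simp only [e1, e2, map_add, map_smul]
    · funext ν
      have e1 : x.1 • y.2.2 (ν * (castPerm 5 τ)⁻¹) = x.1 • y.2.2 (ν * (castPerm 5 ρ)⁻¹) := by
        by_cases h0 : x.1 = 0
        · simp [h0]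
        · obtain ⟨rfl, -⟩ := hx.1 h0
          obtain rfl : n = k := by omega
          rw [hρ.eq_right]
      have e2 : y.1 • x.2.2 (ν * (castPerm 5 σ)⁻¹) = y.1 • x.2.2 (ν * (castPerm 5 ρ)⁻¹) := by
        by_cases h0 : y.1 = 0
        · simp [h0]
        · obtain ⟨rfl, -⟩ := hy.1 h0
          obtain rfl : m = k := by omega
          rw [hρ.eq_left]
      have e3 : treeCoeff E i (E.act (castPerm 3 σ) x.2.1) (E.act (castPerm 3 τ) y.2.1) ν =
          treeCoeff E (σ i : ℕ) x.2.1 y.2.1 (ν * (castPerm 5 ρ)⁻¹) := by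
        by_cases h0 : x.2.1 = 0
        · simp [h0]
        · by_cases h0' : y.2.1 = 0
          · simp [h0']
          · obtain ⟨rfl, -⟩ := hx.2.1 h0
            obtain ⟨rfl, -⟩ := hy.2.1 h0'
            obtain rfl : k = 5 := by omega
            simp only [castPerm_self]
            exact treeCoeff_act i hρ _ _ _
      simp only [Pi.add_apply, Pi.smul_apply, e1, e2, e3]

/-- The inclusion of the generators into the truncation. -/
def truncGen : E.carrier →ₗ[K] (truncFree E d).obj 3 d where
  toFun e := ⟨(0, e, 0), by simp [truncObj]⟩
  map_add' e f := Subtype.ext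
    (show ((0, e + f, 0) : TruncCarrier E) = (0, e, 0) + (0, f, 0) by simp)
  map_smul' c e := Subtype.ext
    (show ((0, c • e, 0) : TruncCarrier E) = c • (0, e, 0) by simp)

/-- The projection of `Γ(E)` onto its truncation. -/
def truncProj : (free E d).Hom (truncFree E d) :=
  freeLift (truncFree E d) (truncGen E d) fun σ e => Subtype.ext (by
    refine Prod.ext rfl (Prod.ext ?_ rfl)
    change E.act σ e = E.act (castPerm 3 σ) e
    rw [castPerm_self])

/-- The coefficients of the two-vertex trees of an element of `Γ(E)(5)`: the element is
`1/12 ∑ ν, (coefficient at ν, composed by ∘_0) · ν`. -/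
def quadCoeff (a : ℤ) : (free E d).obj 5 a →ₗ[K]
    (Equiv.Perm (Fin 5) → E.carrier ⊗[K] E.carrier) :=
  LinearMap.snd K _ _ ∘ₗ LinearMap.snd K _ _ ∘ₗ (truncObj E d 5 a).subtype ∘ₗ
    ((truncProj E d).toFun : (free E d).obj 5 a →ₗ[K] truncObj E d 5 a)

end Truncation

section Dual

variable {K : Type u} [Field K]

/-- The sign of a permutation, in `K`. -/
def sgn (K : Type u) [Field K] {n : ℕ} (σ : Equiv.Perm (Fin n)) : K :=
  ((Equiv.Perm.sign σ : ℤ) : K)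

/-- The right `Σ₃`-module `E^# ⊗ sgn₃`: `(φ · σ)(e) = sgn(σ) φ(e · σ⁻¹)`. -/
def dualSgn (E : SymModule.{u, v} K 3) : SymModule.{u, max u v} K 3 where
  carrier := Module.Dual K E.carrier
  act σ := sgn K σ • (E.act σ⁻¹).dualMap
  act_one φ := by
    ext e
    simp [sgn, E.act_one]
  act_mul σ τ φ := by
    ext e
    simp [sgn, E.act_mul]
    ring

/-- The contraction `(φ ⊗ ψ, e ⊗ f) ↦ φ(e) ψ(f)`. -/
def contract (E : SymModule.{u, v} K 3) :
    ((dualSgn E).carrier ⊗[K] (dualSgn E).carrier) →ₗ[K] (E.carrier ⊗[K] E.carrier) →ₗ[K] K :=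
  TensorProduct.dualDistrib K E.carrier E.carrier

/-- The pairing between `Γ(↑E^# ⊗ sgn₃)(5)` and `Γ(E)(5)`, for `E` in degree `0`:
two-vertex trees whose inner vertices carry different sets of inputs are orthogonal, and trees written
in the same planar form pair to `⟨(φ ∘_i ψ) · ρ, (e ∘_i f) · ρ⟩ = sgn(ρ) φ(e) ψ(f)`. The
formula does not depend on the planar form, so it is averaged over the twelve forms with `i = 0`. -/
def koszulPairing (E : SymModule.{u, v} K 3) :
    (free (dualSgn E) 1).obj 5 2 →ₗ[K] (free E 0).obj 5 0 →ₗ[K] K :=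
  (12 : K)⁻¹ • ∑ ν : Equiv.Perm (Fin 5), sgn K ν •
    (contract E ∘ₗ LinearMap.proj ν ∘ₗ quadCoeff (dualSgn E) 1 2).compl₂
      (LinearMap.proj ν ∘ₗ quadCoeff E 0 0)

/-- Data of a quadratic ternary operad `Γ(E)/(R)`: a finite dimensional `Σ₃`-module `E` of operations of
degree `0` and a `K[Σ₅]`-submodule `R` of `Γ(E)(5)`. -/
structure QuadraticData (K : Type u) [Field K] where
  E : SymModule.{u, v} K 3
  finite : Module.Finite K E.carrier
  R : Submodule K ((free E 0).obj 5 0)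
  act_mem : ∀ (σ : Equiv.Perm (Fin 5)) (x : (free E 0).obj 5 0), x ∈ R → (free E 0).act σ x ∈ R

namespace QuadraticData

variable (P : QuadraticData.{u, v} K)

/-- The quadratic operad `Γ(E)/(R)`. -/
def operad : GrOperad.{u, max u v} K := quotient (free P.E 0) (P.R : Set ((free P.E 0).obj 5 0))

/-- `Γ(Ē)`, the free operad on `Ē = ↑E^# ⊗ sgn₃`, which has degree `1`. -/
abbrev dualFree : GrOperad.{u, max u v} K := free (dualSgn P.E) 1

/-- The annihilator `R^⊥ ⊆ Γ(Ē)(5)` of `R`. -/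
def dualRelations : Submodule K (P.dualFree.obj 5 2) where
  carrier := {x | ∀ r ∈ P.R, koszulPairing P.E x r = 0}
  zero_mem' r _ := by simp
  add_mem' hx hy r hr := by simp [hx r hr, hy r hr]
  smul_mem' c x hx r hr := by simp [hx r hr]

/-- The dual operad `P^! = Γ(Ē)/(R^⊥)`. -/
def dualOperad : GrOperad.{u, max u v} K :=
  quotient P.dualFree (P.dualRelations : Set (P.dualFree.obj 5 2))

end QuadraticData

end Dual

/-! ### `σ`-totally and `σ`-partially associative ternary algebras -/

section Associative

variable {K : Type u} [Field K]

/-- `x ∘_i y` for ternary operations of degree `d`; the inputs are numbered `0, 1, 2`. -/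
def plug (P : GrOperad.{u, v} K) {d e : ℤ} (h : d + d = e) (i : Fin 3) (x y : P.obj 3 d) :
    P.obj 5 e :=
  P.comp (by norm_num) h i x y

/-- `μ ∘ (μ ⊗ I₂) - μ ∘ (I_p ⊗ (μ · σ^p) ⊗ I_{2-p})`, where `p = 0, 1, 2`. -/
def totAssRel (P : GrOperad.{u, v} K) {d e : ℤ} (h : d + d = e) (σ : Equiv.Perm (Fin 3)) (p : Fin 3)
    (μ : P.obj 3 d) : P.obj 5 e :=
  plug P h 0 μ μ - plug P h p μ (P.act (σ ^ (p : ℕ)) μ)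

/-- `∑_{p=0}^{2} (-1)^{2p} sgn(σ)^p μ ∘ (I_p ⊗ (μ · σ^p) ⊗ I_{2-p})`. -/
def partAssRel (P : GrOperad.{u, v} K) {d e : ℤ} (h : d + d = e) (σ : Equiv.Perm (Fin 3))
    (μ : P.obj 3 d) : P.obj 5 e :=
  ∑ p : Fin 3, ((-1) ^ (2 * (p : ℕ)) * sgn K σ ^ (p : ℕ)) •
    plug P h p μ (P.act (σ ^ (p : ℕ)) μ)

/-- `K[Σ₃]` as a right module over itself; an element is written as its coefficient function, and
`π · σ = πσ` on the basis of permutations. -/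
def regular (K : Type u) [Field K] : SymModule.{u, u} K 3 where
  carrier := Equiv.Perm (Fin 3) → K
  act σ := LinearMap.funLeft K K fun π => π * σ⁻¹
  act_one x := by
    funext π
    simp [LinearMap.funLeft_apply]
  act_mul σ τ x := by
    funext π
    simp [LinearMap.funLeft_apply, mul_assoc]

/-- The generator `1` of `K[Σ₃]`. -/
def regularGen (K : Type u) [Field K] : (regular K).carrier :=
  (Pi.single 1 1 : Equiv.Perm (Fin 3) → K)

/-- The linear form on `K[Σ₃]` dual to the generator: the coefficient of the identity. -/
def regularDualGen (K : Type u) [Field K] : (dualSgn (regular K)).carrier :=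
  (LinearMap.proj 1 : (Equiv.Perm (Fin 3) → K) →ₗ[K] K)

/-- The transposition `τ₁₃`. -/
def tau13 : Equiv.Perm (Fin 3) := Equiv.swap 0 2

/-- The `K[Σ₅]`-submodule of `P(5)` generated by a set. -/
def symSpan (P : GrOperad.{u, v} K) {a : ℤ} (S : Set (P.obj 5 a)) : Submodule K (P.obj 5 a) :=
  Submodule.span K {y | ∃ σ : Equiv.Perm (Fin 5), ∃ x ∈ S, y = P.act σ x}

theorem symSpan_act_mem (P : GrOperad.{u, v} K) {a : ℤ} (S : Set (P.obj 5 a))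
    (σ : Equiv.Perm (Fin 5)) (x : P.obj 5 a) (hx : x ∈ symSpan P S) :
    P.act σ x ∈ symSpan P S := by
  induction hx using Submodule.span_induction with
  | mem x hx =>
    obtain ⟨τ, y, hy, rfl⟩ := hx
    exact Submodule.subset_span ⟨τ * σ, y, hy, (P.act_mul _ _ _).symm⟩
  | zero => simp
  | add x y _ _ hx hy => simpa using add_mem hx hy
  | smul c x _ hx => simpa using Submodule.smul_mem _ c hx

/-- The quadratic operad `τ₁₃-ASS` of ternary `τ₁₃`-totally associative algebras, with operation `μ`
of degree `0`. -/
def tau13Ass (K : Type u) [Field K] : QuadraticData.{u, u} K where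
  E := regular K
  finite := inferInstanceAs (Module.Finite K (Equiv.Perm (Fin 3) → K))
  R := symSpan (free (regular K) 0)
    {x | ∃ p : Fin 3, x = totAssRel (free (regular K) 0) (add_zero 0) tau13 p
      (freeGen (regular K) 0 (regularGen K))}
  act_mem := symSpan_act_mem _ _

/-- The operad of ternary `τ₁₃`-partially associative algebras with operation of degree `1`: the
free operad on one ternary operation of degree `1` (without symmetry), modulo the ideal
generated by the `τ₁₃`-partial associativity relation. -/
def tau13PassOne (K : Type u) [Field K] : GrOperad.{u, u} K :=
  quotient (free (regular K) 1)
    {partAssRel (free (regular K) 1) one_add_one_eq_two tau13 (freeGen (regular K) 1 (regularGen K))}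

/-- The generating operation of `τ₁₃-PASS` in degree `1`. -/
def tau13PassOneGen (K : Type u) [Field K] : (tau13PassOne K).obj 3 1 :=
  quotientMk _ _ (freeGen (regular K) 1 (regularGen K))

/-- The ternary operation `α ∈ Ē ⊆ Γ(Ē)(3)` of degree `1` dual to `μ`. -/
def alpha (K : Type u) [Field K] : (tau13Ass K).dualFree.obj 3 1 :=
  freeGen (dualSgn (regular K)) 1 (regularDualGen K)

end Associative

/-! ### The pairing on the trees in `μ` and `α` -/

section PairingFormula

variable {K : Type u} [Field K]

theorem quadCoeff_act_plug (E : SymModule.{u, v} K 3) (d : ℤ) {a : ℤ} (h : d + d = a) (i : Fin 3)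
    (e f : E.carrier) (ρ ν : Equiv.Perm (Fin 5)) :
    quadCoeff E d a ((free E d).act ρ (plug (free E d) h i (freeGen E d e) (freeGen E d f))) ν =
      treeCoeff E i e f (ν * ρ⁻¹) := by
  have h1 : quadCoeff E d a
      ((free E d).act ρ (plug (free E d) h i (freeGen E d e) (freeGen E d f))) ν =
      ((0 : K) • (0 : Equiv.Perm (Fin 5) → E.carrier ⊗[K] E.carrier) +
        (0 : K) • (0 : Equiv.Perm (Fin 5) → E.carrier ⊗[K] E.carrier) + treeCoeff E i e f)
        (ν * (castPerm 5 ρ)⁻¹) := rfl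
  rw [h1, castPerm_self]
  simp

instance {m n k : ℕ} (σ : Equiv.Perm (Fin m)) (τ : Equiv.Perm (Fin n)) (i : Fin m)
    (ρ : Equiv.Perm (Fin k)) : Decidable (IsBlockPerm σ τ i ρ) := by
  unfold IsBlockPerm
  infer_instance

set_option maxRecDepth 100000 in
theorem exists_isBlockPerm : ∀ σ τ : Equiv.Perm (Fin 3),
    ∃ ρ : Equiv.Perm (Fin 5), IsBlockPerm σ τ 0 ρ ∧
      Equiv.Perm.sign ρ = Equiv.Perm.sign σ * Equiv.Perm.sign τ := by
  decide +kernel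

theorem IsBlockPerm.unique {σ τ : Equiv.Perm (Fin 3)} {ρ ρ' : Equiv.Perm (Fin 5)}
    (h : IsBlockPerm σ τ 0 ρ) (h' : IsBlockPerm σ τ 0 ρ') : ρ = ρ' := by
  have key : ∀ a : Fin 5, (∃ j : Fin 3, j ≠ 0 ∧ (a : ℕ) = outerSlot 3 (0 : Fin 3) j) ∨
      ∃ l : Fin 3, (a : ℕ) = (0 : Fin 3) + l := by decide
  ext a
  rcases key a with ⟨j, hj, ha⟩ | ⟨l, ha⟩
  · rw [h.1 j hj a ha, h'.1 j hj a ha]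
  · rw [h.2 l a ha, h'.2 l a ha]

theorem contract_tmul (E : SymModule.{u, v} K 3) (φ ψ : (dualSgn E).carrier) (e f : E.carrier) :
    contract E (φ ⊗ₜ ψ) (e ⊗ₜ f) = (id φ : Module.Dual K E.carrier) e *
      (id ψ : Module.Dual K E.carrier) f :=
  TensorProduct.dualDistrib_apply _ _ _ _

theorem regular_act_gen (σ π : Equiv.Perm (Fin 3)) :
    (id ((dualSgn (regular K)).act σ (regularDualGen K)) : Module.Dual K (regular K).carrier)
      ((regular K).act π (regularGen K)) = if σ = π then sgn K σ else 0 := by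
  change sgn K σ * (Pi.single 1 1 : Equiv.Perm (Fin 3) → K) (1 * (σ⁻¹)⁻¹ * π⁻¹) = _
  rw [Pi.single_apply]
  simp [mul_inv_eq_one]

open Classical in
theorem contract_treeCoeff (i j : ℕ) (ν ν' : Equiv.Perm (Fin 5)) :
    contract (regular K) (treeCoeff (dualSgn (regular K)) i (regularDualGen K) (regularDualGen K) ν)
        (treeCoeff (regular K) j (regularGen K) (regularGen K) ν') =
      ∑ σ : Equiv.Perm (Fin 3), ∑ τ : Equiv.Perm (Fin 3),
        if ((σ 0 : ℕ) = i ∧ IsBlockPerm σ τ 0 ν⁻¹) ∧ ((σ 0 : ℕ) = j ∧ IsBlockPerm σ τ 0 ν'⁻¹)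
        then sgn K σ * sgn K τ else 0 := by
  simp only [treeCoeff, LinearMap.mk₂_apply, map_sum, LinearMap.sum_apply]
  have key : ∀ σ τ σ' τ' : Equiv.Perm (Fin 3), ∀ (p q : Prop) [Decidable p] [Decidable q],
      contract (regular K) (if p then
          (dualSgn (regular K)).act σ (regularDualGen K) ⊗ₜ[K]
            (dualSgn (regular K)).act τ (regularDualGen K) else 0)
        (if q then (regular K).act σ' (regularGen K) ⊗ₜ[K] (regular K).act τ' (regularGen K)
          else 0) =
      if σ = σ' ∧ τ = τ' ∧ p ∧ q then sgn K σ * sgn K τ else 0 := by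
    intro σ τ σ' τ' p q _ _
    by_cases hp : p <;> by_cases hq : q <;> simp only [hp, hq, if_true, if_false, map_zero,
      LinearMap.zero_apply, and_false, and_true, contract_tmul, regular_act_gen]
    by_cases h : σ = σ' <;> by_cases h' : τ = τ' <;> simp [h, h']
  simp only [key]
  refine Finset.sum_congr rfl fun σ _ => ?_
  refine Finset.sum_congr rfl fun τ _ => ?_
  rw [Finset.sum_eq_single σ, Finset.sum_eq_single τ]
  · simp
  · intro τ' _ h
    simp [h]
  · simp
  · intro σ' _ h
    simp [h]
  · simp

theorem sgn_mul {n : ℕ} (σ τ : Equiv.Perm (Fin n)) : sgn K (σ * τ) = sgn K σ * sgn K τ := by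
  simp [sgn]

theorem sgn_mul_self {n : ℕ} (σ : Equiv.Perm (Fin n)) : sgn K σ * sgn K σ = 1 := by
  rcases Int.units_eq_one_or (Equiv.Perm.sign σ) with h | h <;> simp [sgn, h]

theorem sgn_inv {n : ℕ} (σ : Equiv.Perm (Fin n)) : sgn K σ⁻¹ = sgn K σ := by
  simp [sgn]

/-- The pairing on the bases `(α ∘_i α) · ρ` and `(μ ∘_j μ) · ρ'`: trees of the same shape and the
same labelling pair to the sign of the labelling, all others to `0`. -/
theorem koszulPairing_alpha_mu [CharZero K] (i j : Fin 3) (ρ ρ' : Equiv.Perm (Fin 5)) :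
    koszulPairing (regular K)
      ((free (dualSgn (regular K)) 1).act ρ
        (plug (free (dualSgn (regular K)) 1) one_add_one_eq_two i (alpha K) (alpha K)))
      ((free (regular K) 0).act ρ'
        (plug (free (regular K) 0) (add_zero 0) j (freeGen (regular K) 0 (regularGen K))
          (freeGen (regular K) 0 (regularGen K)))) =
      if i = j ∧ ρ = ρ' then sgn K ρ else 0 := by
  classical
  have h0 : ∀ x y, koszulPairing (regular K) x y = (12 : K)⁻¹ * ∑ ν : Equiv.Perm (Fin 5),
      sgn K ν * contract (regular K) (quadCoeff (dualSgn (regular K)) 1 2 x ν)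
        (quadCoeff (regular K) 0 0 y ν) := by
    intro x y
    simp [koszulPairing, LinearMap.sum_apply]
  rw [h0]
  simp only [alpha]
  simp only [quadCoeff_act_plug, contract_treeCoeff]
  by_cases hc : i = j ∧ ρ = ρ'
  · obtain ⟨rfl, rfl⟩ := hc
    rw [if_pos ⟨rfl, rfl⟩]
    simp only [and_self, Finset.mul_sum]
    rw [Finset.sum_comm]
    have h1 : ∀ σ : Equiv.Perm (Fin 3), (∑ ν : Equiv.Perm (Fin 5), ∑ τ : Equiv.Perm (Fin 3),
        (12 : K)⁻¹ * (sgn K ν * if (σ 0 : ℕ) = i ∧ IsBlockPerm σ τ 0 (ν * ρ⁻¹)⁻¹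
          then sgn K σ * sgn K τ else 0)) = if σ 0 = i then 2⁻¹ * sgn K ρ else 0 := by
      intro σ
      by_cases hσ : σ 0 = i
      · rw [Finset.sum_comm, if_pos hσ]
        have h2 : ∀ τ : Equiv.Perm (Fin 3), (∑ ν : Equiv.Perm (Fin 5),
            (12 : K)⁻¹ * (sgn K ν * if (σ 0 : ℕ) = i ∧ IsBlockPerm σ τ 0 (ν * ρ⁻¹)⁻¹
              then sgn K σ * sgn K τ else 0)) = 12⁻¹ * sgn K ρ := by
          intro τ
          obtain ⟨β, hβ, hs⟩ := exists_isBlockPerm σ τ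
          rw [Finset.sum_eq_single (β⁻¹ * ρ)]
          · have hs' : sgn K β = sgn K σ * sgn K τ := by simp [sgn, hs]
            have hb : (β⁻¹ * ρ * ρ⁻¹)⁻¹ = β := by group
            rw [hb, if_pos ⟨by rw [hσ], hβ⟩, ← hs', sgn_mul, sgn_inv]
            rw [mul_right_comm, sgn_mul_self, one_mul]
          · intro ν _ hν
            rw [if_neg, mul_zero, mul_zero]
            rintro ⟨-, hb⟩
            refine hν ?_
            rw [hβ.unique hb]
            group
          · simp
        simp only [h2, Finset.sum_const, Finset.card_univ, Fintype.card_perm, Fintype.card_fin]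
        simp only [Nat.factorial, nsmul_eq_mul]
        norm_num
        ring
      · have hσ' : (σ 0 : ℕ) ≠ i := fun h => hσ (Fin.ext h)
        simp [hσ, hσ']
    have h3 : (Finset.univ.filter fun σ : Equiv.Perm (Fin 3) => σ 0 = i).card = 2 := by
      fin_cases i <;> decide
    simp only [h1]
    rw [← Finset.sum_filter, Finset.sum_const, h3, nsmul_eq_mul]
    norm_num
    ring
  · rw [if_neg hc]
    simp only [mul_eq_zero, inv_eq_zero]
    right
    refine Finset.sum_eq_zero fun ν _ => ?_
    rw [Finset.sum_eq_zero, mul_zero]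
    intro σ _
    refine Finset.sum_eq_zero fun τ _ => if_neg ?_
    rintro ⟨⟨ha, hb⟩, ha', hb'⟩
    refine hc ⟨Fin.ext (ha.symm.trans ha'), ?_⟩
    have := hb.unique hb'
    simpa using this

end PairingFormula

end TernaryOperad


end

/-! Everything reduces to a computation with labelled trees. The module `E^# ⊗ sgn₃` is again free
of rank one over `K[Σ₃]`, generated by the form `α` dual to `μ`. Hence `Γ(Ē)(5)` in degree `2` is
spanned by the trees `(α ∘_i α) · ρ`, with three shapes and 120 labellings (`span_alphaTree`). The
pairing of these with the trees `(μ ∘_j μ) · ρ'` is diagonal, with entries `sgn ρ`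
(`koszulPairing_alpha_mu`).

With inputs counted from `0`, twisting the inner vertex of a `∘_1`-tree by `τ₁₃` amounts to
relabelling by the transposition `s = (1 3)` of `Σ₅` (`plug_one_swap`). So `R` is spanned by the
differences `(μ ∘_0 μ)·ρ - (μ ∘_1 μ)·sρ` and `(μ ∘_0 μ)·ρ - (μ ∘_2 μ)·ρ`. A combination `∑ c(i,ρ) (α
∘_i α)·ρ` annihilates them exactly when `c(1,sρ) = -c(0,ρ)` and `c(2,ρ) = c(0,ρ)`; the minus sign is
`sgn s`. Such a combination is `∑ c(0,ρ)` times the translate by `ρ` of the partial associativity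
relation (`forall_totAss_iff_mem`).

The spanning statement needs an argument because the free operad is a quotient of formal
expressions. Generators have degree `1`, so the degree counts vertices, and an induction on
expressions gives the shape of all elements with at most two vertices (`mem_lowArity`). Independence
of the trees is not needed separately: the diagonal pairing reads off coefficients.

For the dual operad, the isomorphism `K[Σ₃] ≃ E^# ⊗ sgn₃` induces mutually inverse morphisms of free
operads. They match the two sets of relations, hence the two ideals, and so descend to the quotients
(`quotientMap_isIso`). -/

namespace TernaryOperad

universe u v w

/-! ### Morphisms of free operads and of their quotients -/

section Morphisms

variable {K : Type u} [Field K]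

/-- Composition of morphisms of graded operads. -/
def GrOperad.Hom.comp {P : GrOperad.{u, v} K} {Q : GrOperad.{u, w} K} {S : GrOperad.{u, v} K}
    (g : Q.Hom S) (f : P.Hom Q) : P.Hom S where
  toFun := g.toFun ∘ₗ f.toFun
  map_one := by simp [f.map_one, g.map_one]
  map_act σ x := by simp [f.map_act, g.map_act]
  map_comp h h' i x y := by simp [f.map_comp, g.map_comp]

/-- A morphism out of a free operad is determined by its values on the generators. -/
theorem free_hom_ext {E : SymModule.{u, v} K 3} {d : ℤ} {Q : GrOperad.{u, w} K}
    (f g : (free E d).Hom Q) (h : ∀ e, f.toFun (freeGen E d e) = g.toFun (freeGen E d e))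
    {n : ℕ} {a : ℤ} (x : (free E d).obj n a) : f.toFun x = g.toFun x := by
  obtain ⟨t, rfl⟩ := Quot.exists_rep x
  induction t with
  | zero n a =>
    exact (map_zero (f.toFun (n := n) (a := a))).trans (map_zero (g.toFun (n := n) (a := a))).symm
  | add x y hx hy =>
    exact (map_add f.toFun (FreeObj.mk x) (FreeObj.mk y)).trans ((congrArg₂ _ hx hy).trans
      (map_add g.toFun (FreeObj.mk x) (FreeObj.mk y)).symm)
  | smul c x hx =>
    exact (map_smul f.toFun c (FreeObj.mk x)).trans ((congrArg _ hx).trans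
      (map_smul g.toFun c (FreeObj.mk x)).symm)
  | one => exact f.map_one.trans g.map_one.symm
  | gen e => exact h e
  | act σ x hx =>
    refine (f.map_act σ (Quot.mk _ x)).trans ?_
    refine Eq.trans ?_ (g.map_act σ (Quot.mk _ x)).symm
    rw [hx]
  | comp h₁ h₂ i x y hx hy =>
    refine (f.map_comp h₁ h₂ i (Quot.mk _ x) (Quot.mk _ y)).trans ?_
    refine Eq.trans ?_ (g.map_comp h₁ h₂ i (Quot.mk _ x) (Quot.mk _ y)).symm
    rw [hx, hy]

/-- The morphism of free operads induced by an equivariant linear map of generators. -/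
def freeMap {E : SymModule.{u, v} K 3} {E' : SymModule.{u, w} K 3} (d : ℤ)
    (θ : E.carrier →ₗ[K] E'.carrier) (hθ : ∀ σ e, θ (E.act σ e) = E'.act σ (θ e)) :
    (free E d).Hom (free E' d) :=
  freeLift (free E' d) (freeGen E' d ∘ₗ θ) fun σ e => by
    rw [LinearMap.comp_apply, hθ]
    exact Quot.sound (.gen_act σ _)

theorem freeMap_gen {E : SymModule.{u, v} K 3} {E' : SymModule.{u, w} K 3} (d : ℤ)
    (θ : E.carrier →ₗ[K] E'.carrier) (hθ : ∀ σ e, θ (E.act σ e) = E'.act σ (θ e))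
    (e : E.carrier) : (freeMap d θ hθ).toFun (freeGen E d e) = freeGen E' d (θ e) := rfl

/-- The composite fixes the generators, as the identity morphism does, and a morphism out of a free
operad is determined there. -/
theorem freeMap_leftInverse {E : SymModule.{u, v} K 3} {E' : SymModule.{u, w} K 3} (d : ℤ)
    (θ : E.carrier →ₗ[K] E'.carrier) (hθ : ∀ σ e, θ (E.act σ e) = E'.act σ (θ e))
    (η : E'.carrier →ₗ[K] E.carrier) (hη : ∀ σ e, η (E'.act σ e) = E.act σ (η e))
    (h : ∀ e, η (θ e) = e) {n : ℕ} {a : ℤ} (x : (free E d).obj n a) :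
    (freeMap d η hη).toFun ((freeMap d θ hθ).toFun x) = x := by
  let i : (free E d).Hom (free E d) :=
    { toFun := LinearMap.id
      map_one := rfl
      map_act := fun _ _ => rfl
      map_comp := fun _ _ _ _ _ => rfl }
  refine free_hom_ext ((freeMap d η hη).comp (freeMap d θ hθ)) i (fun e => ?_) x
  change (freeMap d η hη).toFun ((freeMap d θ hθ).toFun (freeGen E d e)) = freeGen E d e
  rw [freeMap_gen, freeMap_gen, h]

/-- A morphism carrying `R` into the ideal `(R')` carries the ideal `(R)` into `(R')`. -/
theorem IdealMem.map {P : GrOperad.{u, v} K} {Q : GrOperad.{u, w} K} (f : P.Hom Q)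
    {n₀ : ℕ} {a₀ : ℤ} {R : Set (P.obj n₀ a₀)} {R' : Set (Q.obj n₀ a₀)}
    (hf : ∀ x ∈ R, IdealMem Q R' n₀ a₀ (f.toFun x)) {n : ℕ} {a : ℤ} {x : P.obj n a}
    (hx : IdealMem P R n a x) : IdealMem Q R' n a (f.toFun x) := by
  induction hx with
  | of x hx => exact hf x hx
  | zero n a => rw [map_zero]; exact .zero n a
  | add x y _ _ hx hy => rw [map_add]; exact .add _ _ hx hy
  | smul c x _ hx => rw [map_smul]; exact .smul c _ hx
  | act σ x _ hx => rw [f.map_act]; exact .act σ _ hx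
  | comp_left h h' i x y _ hx => rw [f.map_comp]; exact .comp_left h h' i _ _ hx
  | comp_right h h' i x y _ hy => rw [f.map_comp]; exact .comp_right h h' i _ _ hy

/-- The morphism of quotient operads induced by a morphism carrying `R` into the ideal `(R')`. -/
def quotientMap {P : GrOperad.{u, v} K} {Q : GrOperad.{u, w} K} (f : P.Hom Q)
    {n₀ : ℕ} {a₀ : ℤ} (R : Set (P.obj n₀ a₀)) (R' : Set (Q.obj n₀ a₀))
    (hf : ∀ x ∈ R, IdealMem Q R' n₀ a₀ (f.toFun x)) : (quotient P R).Hom (quotient Q R') where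
  toFun {n a} := Submodule.mapQ (ideal P R n a) (ideal Q R' n a) f.toFun
    fun _ hx => IdealMem.map f hf hx
  map_one := congrArg Submodule.Quotient.mk f.map_one
  map_act σ x := by
    induction x using Submodule.Quotient.induction_on with
    | H x => exact congrArg Submodule.Quotient.mk (f.map_act σ x)
  map_comp h h' i x y := by
    induction x using Submodule.Quotient.induction_on with
    | H x =>
    induction y using Submodule.Quotient.induction_on with
    | H y => exact congrArg Submodule.Quotient.mk (f.map_comp h h' i x y)

/-- Mutually inverse morphisms that match the relations induce an isomorphism of the quotients. -/
theorem quotientMap_isIso {P : GrOperad.{u, v} K} {Q : GrOperad.{u, w} K} (f : P.Hom Q)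
    (g : Q.Hom P) {n₀ : ℕ} {a₀ : ℤ} (R : Set (P.obj n₀ a₀)) (R' : Set (Q.obj n₀ a₀))
    (hf : ∀ x ∈ R, IdealMem Q R' n₀ a₀ (f.toFun x))
    (hg : ∀ x ∈ R', IdealMem P R n₀ a₀ (g.toFun x))
    (hgf : ∀ {n a} (x : P.obj n a), g.toFun (f.toFun x) = x)
    (hfg : ∀ {n a} (x : Q.obj n a), f.toFun (g.toFun x) = x) :
    (quotientMap f R R' hf).IsIso := by
  intro n a
  refine Function.bijective_iff_has_inverse.2 ⟨(quotientMap g R' R hg).toFun, fun x => ?_,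
    fun x => ?_⟩
  · induction x using Submodule.Quotient.induction_on with
    | H x => exact congrArg Submodule.Quotient.mk (hgf x)
  · induction x using Submodule.Quotient.induction_on with
    | H x => exact congrArg Submodule.Quotient.mk (hfg x)

theorem GrOperad.Hom.map_plug {P : GrOperad.{u, v} K} {Q : GrOperad.{u, w} K} (f : P.Hom Q)
    {d e : ℤ} (h : d + d = e) (i : Fin 3) (x y : P.obj 3 d) :
    f.toFun (plug P h i x y) = plug Q h i (f.toFun x) (f.toFun y) :=
  f.map_comp _ _ _ _ _

/-- An operadic ideal is stable under linear combinations and the symmetric group. This reduces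
membership of all of `R^⊥` in an ideal to that of its single generator. -/
theorem symSpan_le_idealMem (P : GrOperad.{u, v} K) {a : ℤ} (S : Set (P.obj 5 a)) {x : P.obj 5 a}
    (hx : x ∈ symSpan P S) : IdealMem P S 5 a x := by
  induction hx using Submodule.span_induction with
  | mem x hx =>
    obtain ⟨σ, y, hy, rfl⟩ := hx
    exact .act σ y (.of y hy)
  | zero => exact .zero _ _
  | add x y _ _ hx hy => exact .add _ _ hx hy
  | smul c x _ hx => exact .smul c _ hx

theorem mem_symSpan (P : GrOperad.{u, v} K) {a : ℤ} {S : Set (P.obj 5 a)} {x : P.obj 5 a}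
    (hx : x ∈ S) : x ∈ symSpan P S :=
  Submodule.subset_span ⟨1, x, hx, (P.act_one x).symm⟩

end Morphisms

/-! ### Elements of the free operad with at most two vertices -/

section LowArity

variable {K : Type u} [Field K] (E : SymModule.{u, v} K 3)

/-- The span of the two-vertex trees in the free operad on generators of degree `1`. -/
def twoVertexSpan : Submodule K ((free E 1).obj 5 2) :=
  Submodule.span K {x | ∃ (ρ : Equiv.Perm (Fin 5)) (i : Fin 3) (e f : E.carrier),
    x = (free E 1).act ρ (plug (free E 1) one_add_one_eq_two i (freeGen E 1 e) (freeGen E 1 f))}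

theorem act_mem_twoVertexSpan (σ : Equiv.Perm (Fin 5)) {x : (free E 1).obj 5 2}
    (hx : x ∈ twoVertexSpan E) : (free E 1).act σ x ∈ twoVertexSpan E := by
  induction hx using Submodule.span_induction with
  | mem x hx =>
    obtain ⟨ρ, i, e, f, rfl⟩ := hx
    exact Submodule.subset_span ⟨ρ * σ, i, e, f, ((free E 1).act_mul _ _ _).symm⟩
  | zero => simp
  | add x y _ _ hx hy => simpa using add_mem hx hy
  | smul c x _ hx => simpa using Submodule.smul_mem _ c hx

/-- The elements of arity `n` and degree `a` that have the expected form when there are at most two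
vertices, the generators having degree `1`. -/
def lowArity (n : ℕ) (a : ℤ) : Submodule K ((free E 1).obj n a) where
  -- A ternary vertex of degree `1` adds `1` to the degree and `2` to the arity, whence `n = 2a +
  -- 1`. The casts let one predicate, defined for all `n` and `a`, speak of the three special
  -- components, as an induction on expressions requires.
  carrier := {x | (x ≠ 0 → 0 ≤ a ∧ (n : ℤ) = 2 * a + 1) ∧
    (∀ (h : n = 1) (h' : a = 0), cast (congrArg₂ (free E 1).obj h h') x ∈ Submodule.span K {(free E 1).one}) ∧
    (∀ (h : n = 3) (h' : a = 1), cast (congrArg₂ (free E 1).obj h h') x ∈ LinearMap.range (freeGen E 1)) ∧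
    (∀ (h : n = 5) (h' : a = 2), cast (congrArg₂ (free E 1).obj h h') x ∈ twoVertexSpan E)}
  zero_mem' := by
    refine ⟨by simp, ?_, ?_, ?_⟩ <;> (rintro rfl rfl; exact zero_mem _)
  add_mem' := by
    rintro x y ⟨h0, h1, h2, h3⟩ ⟨k0, k1, k2, k3⟩
    refine ⟨fun h => ?_, ?_, ?_, ?_⟩
    · by_cases hx : x = 0
      · exact k0 fun hy => h (by simp [hx, hy])
      · exact h0 hx
    · rintro rfl rfl; exact add_mem (h1 rfl rfl) (k1 rfl rfl)
    · rintro rfl rfl; exact add_mem (h2 rfl rfl) (k2 rfl rfl)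
    · rintro rfl rfl; exact add_mem (h3 rfl rfl) (k3 rfl rfl)
  smul_mem' := by
    rintro c x ⟨h0, h1, h2, h3⟩
    refine ⟨fun h => h0 fun hx => h (by simp [hx]), ?_, ?_, ?_⟩
    · rintro rfl rfl; exact Submodule.smul_mem _ c (h1 rfl rfl)
    · rintro rfl rfl; exact Submodule.smul_mem _ c (h2 rfl rfl)
    · rintro rfl rfl; exact Submodule.smul_mem _ c (h3 rfl rfl)

theorem act_mem_lowArity {n : ℕ} {a : ℤ} (σ : Equiv.Perm (Fin n)) {x : (free E 1).obj n a}
    (hx : x ∈ lowArity E n a) : (free E 1).act σ x ∈ lowArity E n a := by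
  obtain ⟨h0, h1, h2, h3⟩ := hx
  refine ⟨fun h => h0 fun hx => h (by simp [hx]), ?_, ?_, ?_⟩
  · rintro rfl rfl
    rw [Subsingleton.elim σ 1]
    simpa only [(free E 1).act_one] using h1 rfl rfl
  · rintro rfl rfl
    obtain ⟨e, rfl⟩ := h2 rfl rfl
    exact ⟨E.act σ e, Quot.sound (.gen_act σ e)⟩
  · rintro rfl rfl
    exact act_mem_twoVertexSpan E σ (h3 rfl rfl)

/-- Vertex counts add under composition. If a nonzero factor has no vertex, it is a multiple of the
unit and the composite is a multiple of the other factor. Otherwise the composite has at least two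
vertices, and exactly two only when both factors are generators. -/
theorem comp_mem_lowArity {m n k : ℕ} {a b c : ℤ} (h : m + n = k + 1) (h' : a + b = c) (i : Fin m)
    {x : (free E 1).obj m a} {y : (free E 1).obj n b}
    (hx : x ∈ lowArity E m a) (hy : y ∈ lowArity E n b) :
    (free E 1).comp h h' i x y ∈ lowArity E k c := by
  by_cases x0 : x = 0
  · simp [x0]
  by_cases y0 : y = 0
  · simp [y0]
  have ⟨ha, hm⟩ := hx.1 x0
  have ⟨hb, hn⟩ := hy.1 y0
  by_cases a0 : a = 0
  · subst a0
    obtain rfl : m = 1 := by omega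
    obtain rfl : n = k := by omega
    obtain rfl : b = c := by omega
    obtain ⟨s, rfl⟩ := Submodule.mem_span_singleton.1 (hx.2.1 rfl rfl)
    rw [map_smul, LinearMap.smul_apply, (free E 1).one_comp]
    exact Submodule.smul_mem _ _ hy
  by_cases b0 : b = 0
  · subst b0
    obtain rfl : n = 1 := by omega
    obtain rfl : m = k := by omega
    obtain rfl : a = c := by omega
    obtain ⟨s, rfl⟩ := Submodule.mem_span_singleton.1 (hy.2.1 rfl rfl)
    rw [map_smul, (free E 1).comp_one]
    exact Submodule.smul_mem _ _ hx
  -- Now `a, b ≥ 1`, so `c ≥ 2`: the clauses for degrees `0` and `1` are vacuous, and `c = 2` forces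
  -- `a = b = 1` and both arities to be `3`.
  refine ⟨fun _ => by omega, ?_, ?_, ?_⟩
  · intros; omega
  · intros; omega
  · rintro rfl rfl
    obtain rfl : a = 1 := by omega
    obtain rfl : b = 1 := by omega
    obtain rfl : m = 3 := by omega
    obtain rfl : n = 3 := by omega
    obtain ⟨e, rfl⟩ := hx.2.2.1 rfl rfl
    obtain ⟨f, rfl⟩ := hy.2.2.1 rfl rfl
    exact Submodule.subset_span ⟨1, i, e, f, ((free E 1).act_one _).symm⟩

theorem mem_lowArity {n : ℕ} {a : ℤ} (x : (free E 1).obj n a) : x ∈ lowArity E n a := by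
  obtain ⟨t, rfl⟩ := Quot.exists_rep x
  induction t with
  | zero n a => exact zero_mem (lowArity E n a)
  | add x y hx hy => exact add_mem hx hy
  | smul c x hx => exact Submodule.smul_mem _ c hx
  | one =>
    refine ⟨fun _ => by norm_num, ?_, ?_, ?_⟩
    · intro _ _; exact Submodule.mem_span_singleton_self _
    · intros; omega
    · intros; omega
  | gen e =>
    refine ⟨fun _ => by norm_num, ?_, ?_, ?_⟩
    · intros; omega
    · intro _ _; exact ⟨e, rfl⟩
    · intros; omega
  | act σ x hx => exact act_mem_lowArity E σ hx
  | comp h h' i x y hx hy => exact comp_mem_lowArity E h h' i hx hy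

/-- The only instance of `mem_lowArity` used later; the other components are there to carry the
induction. -/
theorem mem_twoVertexSpan (x : (free E 1).obj 5 2) : x ∈ twoVertexSpan E :=
  (mem_lowArity E x).2.2.2 rfl rfl

end LowArity

/-! ### The regular module is its own signed dual -/

section Regular

variable (K : Type u) [Field K]

theorem regular_act_regularGen (σ : Equiv.Perm (Fin 3)) :
    (regular K).act σ (regularGen K) = (Pi.single σ 1 : Equiv.Perm (Fin 3) → K) := by
  funext π
  change (Pi.single 1 1 : Equiv.Perm (Fin 3) → K) (π * σ⁻¹) = _
  simp [Pi.single_apply, mul_inv_eq_one]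

/-- The equivariant map `K[Σ₃] → K[Σ₃]^# ⊗ sgn₃` sending the generator to the dual generator. -/
def toDual : (regular K).carrier →ₗ[K] (dualSgn (regular K)).carrier :=
  Fintype.linearCombination K fun σ => (dualSgn (regular K)).act σ (regularDualGen K)

theorem toDual_apply (x : Equiv.Perm (Fin 3) → K) :
    toDual K x = ∑ σ, x σ • (dualSgn (regular K)).act σ (regularDualGen K) := rfl

theorem toDual_act (ρ : Equiv.Perm (Fin 3)) (x : (regular K).carrier) :
    toDual K ((regular K).act ρ x) = (dualSgn (regular K)).act ρ (toDual K x) := by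
  refine (toDual_apply K _).trans ?_
  refine Eq.trans ?_ (congrArg _ (toDual_apply K x)).symm
  rw [map_sum]
  refine Fintype.sum_equiv (Equiv.mulRight ρ⁻¹) _ _ fun σ => ?_
  rw [map_smul, ← SymModule.act_mul]
  simp only [Equiv.coe_mulRight, inv_mul_cancel_right]
  rfl

/-- The inverse of `toDual`. -/
def ofDual : (dualSgn (regular K)).carrier →ₗ[K] (regular K).carrier :=
  LinearMap.pi (φ := fun _ : Equiv.Perm (Fin 3) => K) fun σ =>
    -- The form `α · σ` takes the value `sgn σ` at `μ · σ`, so the factor `sgn σ` normalises the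
    -- coordinate along `α · σ` to `1`.
    sgn K σ • (Module.Dual.eval K (regular K).carrier ((regular K).act σ (regularGen K)))

theorem ofDual_apply (φ : (dualSgn (regular K)).carrier) (σ : Equiv.Perm (Fin 3)) :
    (ofDual K φ : Equiv.Perm (Fin 3) → K) σ =
      sgn K σ * (id φ : Module.Dual K (regular K).carrier)
        ((regular K).act σ (regularGen K)) := rfl

theorem ofDual_act (ρ : Equiv.Perm (Fin 3)) (φ : (dualSgn (regular K)).carrier) :
    ofDual K ((dualSgn (regular K)).act ρ φ) = (regular K).act ρ (ofDual K φ) := by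
  funext σ
  refine (ofDual_apply K _ σ).trans ?_
  change sgn K σ * (sgn K ρ * (id φ : Module.Dual K (regular K).carrier)
    ((regular K).act ρ⁻¹ ((regular K).act σ (regularGen K)))) =
      (ofDual K φ : Equiv.Perm (Fin 3) → K) (σ * ρ⁻¹)
  rw [ofDual_apply, sgn_mul, sgn_inv, (regular K).act_mul, mul_assoc]

/-- By `regular_act_gen` the form `α · σ` vanishes on `μ · π` unless `σ = π`, where it equals `sgn
σ`. Evaluation at `μ · π` therefore isolates `x π` up to a sign, which squares to `1`. -/
theorem ofDual_toDual (x : (regular K).carrier) : ofDual K (toDual K x) = x := by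
  funext π
  rw [ofDual_apply]
  have h : (id (toDual K x) : Module.Dual K (regular K).carrier)
        ((regular K).act π (regularGen K)) =
      ∑ σ, (x : Equiv.Perm (Fin 3) → K) σ • if σ = π then sgn K σ else 0 := by
    simp only [← regular_act_gen]
    exact LinearMap.sum_apply Finset.univ
      (fun σ => (id ((x : Equiv.Perm (Fin 3) → K) σ •
        (dualSgn (regular K)).act σ (regularDualGen K)) : Module.Dual K (regular K).carrier)) _
  rw [h]
  simp [mul_left_comm, sgn_mul_self]

/-- A left inverse that is injective is a two-sided inverse. Injectivity holds because a form on
`K[Σ₃]` is determined by its values on the basis `μ · σ`. -/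
theorem toDual_ofDual (φ : (dualSgn (regular K)).carrier) : toDual K (ofDual K φ) = φ := by
  have hinj : Function.Injective (ofDual K) := by
    intro φ ψ h
    refine LinearMap.pi_ext' (R := K) (ι := Equiv.Perm (Fin 3)) (φ := fun _ => K) fun σ => ?_
    refine LinearMap.ext_ring ?_
    have h1 := congrFun h σ
    rw [ofDual_apply, ofDual_apply, regular_act_regularGen] at h1
    have h2 := congrArg (sgn K σ * ·) h1
    simp only [← mul_assoc, sgn_mul_self, one_mul] at h2
    exact h2
  exact hinj (ofDual_toDual K _)

theorem toDual_regularGen : toDual K (regularGen K) = regularDualGen K := by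
  refine (toDual_apply K _).trans ?_
  rw [Finset.sum_eq_single 1]
  · rw [(dualSgn (regular K)).act_one]
    simp [regularGen]
  · intro σ _ h
    simp [regularGen, h]
  · simp

theorem ofDual_regularDualGen : ofDual K (regularDualGen K) = regularGen K := by
  rw [← toDual_regularGen, ofDual_toDual]

end Regular

/-! ### Trees and the two associativity relations -/

section Relations

variable (K : Type u) [Field K]

-- A finite check, allowing permutations of the two vertices of a tree of any shape to be moved
-- outside as a relabelling of its five inputs.
set_option maxRecDepth 100000 in
theorem exists_isBlockPerm_all : ∀ (i : Fin 3) (σ τ : Equiv.Perm (Fin 3)),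
    ∃ ρ : Equiv.Perm (Fin 5), IsBlockPerm σ τ i ρ := by
  decide +kernel

theorem plug_act {P : GrOperad.{u, v} K} {d e : ℤ} (h : d + d = e) (i : Fin 3)
    {σ τ : Equiv.Perm (Fin 3)} {ρ : Equiv.Perm (Fin 5)} (hρ : IsBlockPerm σ τ i ρ)
    (x y : P.obj 3 d) :
    plug P h i (P.act σ x) (P.act τ y) = P.act ρ (plug P h (σ i) x y) :=
  P.comp_act _ _ _ _ _ _ hρ _ _

-- The inner vertex of a `∘_1`-tree occupies the inputs `1, 2, 3`, so exchanging its outer two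
-- inputs exchanges inputs `1` and `3` of the tree.
set_option maxRecDepth 100000 in
theorem isBlockPerm_swap :
    IsBlockPerm (1 : Equiv.Perm (Fin 3)) (Equiv.swap (0 : Fin 3) 2) 1
      (Equiv.swap (1 : Fin 5) 3) := by
  decide +kernel

theorem plug_one_swap {P : GrOperad.{u, v} K} {d e : ℤ} (h : d + d = e) (x : P.obj 3 d) :
    plug P h 1 x (P.act (Equiv.swap 0 2) x) = P.act (Equiv.swap 1 3) (plug P h 1 x x) := by
  have := plug_act K h 1 isBlockPerm_swap x x
  rwa [P.act_one] at this

/-- The generating operation dual to `μ`. -/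
def dualGen : (free (dualSgn (regular K)) 1).obj 3 1 :=
  freeGen (dualSgn (regular K)) 1 (regularDualGen K)

/-- The trees `(α ∘_i α) · ρ`. -/
def alphaTree (p : Fin 3 × Equiv.Perm (Fin 5)) : (free (dualSgn (regular K)) 1).obj 5 2 :=
  (free (dualSgn (regular K)) 1).act p.2
    (plug (free (dualSgn (regular K)) 1) one_add_one_eq_two p.1 (dualGen K) (dualGen K))

/-- The forms `α · σ` span the signed dual, with coordinates given by `ofDual`, so each generator of
`Γ(Ē)` is a combination of permuted copies of `α`. -/
theorem freeGen_dualSgn (φ : (dualSgn (regular K)).carrier) :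
    freeGen (dualSgn (regular K)) 1 φ = ∑ σ, (ofDual K φ : Equiv.Perm (Fin 3) → K) σ •
      (free (dualSgn (regular K)) 1).act σ (dualGen K) := by
  conv_lhs => rw [← toDual_ofDual K φ]
  refine (congrArg _ (toDual_apply K _)).trans ?_
  rw [map_sum]
  refine Finset.sum_congr rfl fun σ _ => ?_
  rw [map_smul]
  exact congrArg _ (Quot.sound (.gen_act σ _))

/-- Two-vertex trees span; expand both vertices in the copies `α · σ` and move the permutations
outside by equivariance of composition. -/
theorem span_alphaTree : Submodule.span K (Set.range (alphaTree K)) = ⊤ := by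
  refine eq_top_iff.2 fun x _ => ?_
  refine Submodule.span_le.2 ?_ (mem_twoVertexSpan (dualSgn (regular K)) x)
  rintro _ ⟨ρ, i, e, f, rfl⟩
  rw [freeGen_dualSgn, freeGen_dualSgn]
  simp only [plug, map_sum, map_smul, LinearMap.sum_apply, LinearMap.smul_apply]
  refine Submodule.sum_mem _ fun τ _ => Submodule.smul_mem _ _ ?_
  refine Submodule.sum_mem _ fun σ _ => Submodule.smul_mem _ _ ?_
  obtain ⟨β, hβ⟩ := exists_isBlockPerm_all i σ τ
  -- Input `i` of `α · σ` is input `σ i` of `α`, which changes the shape of the tree; the block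
  -- permutation `β` is absorbed in the labelling.
  refine Submodule.subset_span ⟨(σ i, β * ρ), ?_⟩
  refine ((free (dualSgn (regular K)) 1).act_mul β ρ _).trans ?_
  exact congrArg _ (plug_act K (P := free (dualSgn (regular K)) 1) one_add_one_eq_two i hβ
    (dualGen K) (dualGen K)).symm

/-- The `τ₁₃`-partial associativity relation for an operation of degree `1`. -/
theorem partAssRel_tau13 (P : GrOperad.{u, v} K) (x : P.obj 3 1) :
    partAssRel P one_add_one_eq_two tau13 x =
      plug P one_add_one_eq_two 0 x x
        - plug P one_add_one_eq_two 1 x (P.act (Equiv.swap 0 2) x)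
        + plug P one_add_one_eq_two 2 x x := by
  -- Since `τ₁₃` is an odd involution, the coefficients are `1, -1, 1` and only the term `p = 1`
  -- keeps a twist.
  have h : sgn K tau13 = -1 := by
    simp [sgn, tau13, Equiv.Perm.sign_swap (show (0 : Fin 3) ≠ 2 by decide)]
  have h2 : tau13 ^ 2 = 1 := by simp [tau13, sq]
  simp [partAssRel, Fin.sum_univ_three, h, h2, P.act_one]
  simp [tau13, sub_eq_add_neg]

/-- The trees `(μ ∘_i μ) · ρ`. -/
def muTree (p : Fin 3 × Equiv.Perm (Fin 5)) : (free (regular K) 0).obj 5 0 :=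
  (free (regular K) 0).act p.2 (plug (free (regular K) 0) (add_zero 0) p.1
    (freeGen (regular K) 0 (regularGen K)) (freeGen (regular K) 0 (regularGen K)))

/-- The relations of `τ₁₃`-total associativity in terms of trees. -/
theorem act_totAssRel (p : Fin 3) (ρ : Equiv.Perm (Fin 5)) :
    (free (regular K) 0).act ρ (totAssRel (free (regular K) 0) (add_zero 0) tau13 p
      (freeGen (regular K) 0 (regularGen K))) =
      muTree K (0, ρ) - muTree K (p, Equiv.swap 1 3 ^ (p % 2 : ℕ) * ρ) := by
  have h2 : tau13 ^ 2 = 1 := by simp [tau13, sq]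
  rw [totAssRel, map_sub]
  refine congrArg₂ _ rfl ?_
  rw [muTree, GrOperad.act_mul]
  refine congrArg _ ?_
  -- Only `p = 1` carries a twist, as `τ₁₃² = 1`; this is what the exponent `p % 2` records. The
  -- case `p = 0` is the trivial relation.
  fin_cases p
  · simp [GrOperad.act_one]
  · simpa [tau13] using plug_one_swap K (P := free (regular K) 0) (add_zero 0)
      (freeGen (regular K) 0 (regularGen K))
  · simp [GrOperad.act_one, h2]

/-- Removing the twist at the cost of a relabelling writes the relation in the spanning trees, with
the same labels `ρ` and `(1 3)ρ` as in `act_totAssRel`, so that the two can be paired. -/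
theorem act_partAssRel (ρ : Equiv.Perm (Fin 5)) :
    (free (dualSgn (regular K)) 1).act ρ
        (plug (free (dualSgn (regular K)) 1) one_add_one_eq_two 0 (dualGen K) (dualGen K)
          - plug (free (dualSgn (regular K)) 1) one_add_one_eq_two 1 (dualGen K)
              ((free (dualSgn (regular K)) 1).act (Equiv.swap 0 2) (dualGen K))
          + plug (free (dualSgn (regular K)) 1) one_add_one_eq_two 2 (dualGen K) (dualGen K)) =
      alphaTree K (0, ρ) - alphaTree K (1, Equiv.swap 1 3 * ρ) + alphaTree K (2, ρ) := by
  rw [map_add, map_sub, plug_one_swap, ← GrOperad.act_mul]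
  rfl

/-- This sign puts the minus in front of the middle term of the dual relation. -/
theorem sgn_swap_mul (ρ : Equiv.Perm (Fin 5)) : sgn K (Equiv.swap 1 3 * ρ) = -sgn K ρ := by
  rw [sgn_mul]
  simp [sgn, Equiv.Perm.sign_swap (show (1 : Fin 5) ≠ 3 by decide)]

/-! ### The orthogonal of total associativity -/

section Orthogonal

variable {K}
  {B : (free (dualSgn (regular K)) 1).obj 5 2 →ₗ[K] (free (regular K) 0).obj 5 0 →ₗ[K] K}

/-- By linearity it suffices to test on translates of the relations, which are differences of two
trees; orthogonality becomes equality of two tree values. -/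
theorem forall_totAss_iff (x : (free (dualSgn (regular K)) 1).obj 5 2) :
    (∀ r ∈ symSpan (free (regular K) 0) {x | ∃ p : Fin 3, x =
      totAssRel (free (regular K) 0) (add_zero 0) tau13 p
        (freeGen (regular K) 0 (regularGen K))}, B x r = 0) ↔ ∀ (p : Fin 3) (ρ : Equiv.Perm (Fin 5)),
      B x (muTree K (0, ρ)) = B x (muTree K (p, Equiv.swap 1 3 ^ (p % 2 : ℕ) * ρ)) := by
  constructor
  · intro hx p ρ
    rw [← sub_eq_zero, ← map_sub, ← act_totAssRel]
    exact hx _ (Submodule.subset_span ⟨ρ, _, ⟨p, rfl⟩, rfl⟩)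
  · intro h r hr
    induction hr using Submodule.span_induction with
    | mem y hy =>
      obtain ⟨ρ, _, ⟨p, rfl⟩, rfl⟩ := hy
      rw [act_totAssRel, map_sub, h p ρ, sub_self]
    | zero => exact map_zero (B x)
    | add y z _ _ hy hz => rw [map_add, hy, hz, add_zero]
    | smul c y _ hy => rw [map_smul, hy, smul_zero]

/-- Diagonality: pairing with one tree in `μ` extracts one coefficient up to sign. -/
theorem apply_sum_alphaTree
    (hB : ∀ p q, B (alphaTree K p) (muTree K q) = if p = q then sgn K p.2 else 0)
    (c : Fin 3 × Equiv.Perm (Fin 5) → K) (q : Fin 3 × Equiv.Perm (Fin 5)) :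
    B (∑ p, c p • alphaTree K p) (muTree K q) = c q * sgn K q.2 := by
  simp [map_sum, LinearMap.sum_apply, hB]

/-- For a pairing with the given values on trees, the orthogonal of the relations of total
associativity is spanned by the relation of partial associativity. -/
theorem forall_totAss_iff_mem
    (hB : ∀ p q, B (alphaTree K p) (muTree K q) = if p = q then sgn K p.2 else 0)
    (x : (free (dualSgn (regular K)) 1).obj 5 2) :
    (∀ r ∈ symSpan (free (regular K) 0) {x | ∃ p : Fin 3, x =
      totAssRel (free (regular K) 0) (add_zero 0) tau13 p
        (freeGen (regular K) 0 (regularGen K))}, B x r = 0) ↔ x ∈ symSpan (free (dualSgn (regular K)) 1)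
      {plug (free (dualSgn (regular K)) 1) one_add_one_eq_two 0 (dualGen K) (dualGen K)
        - plug (free (dualSgn (regular K)) 1) one_add_one_eq_two 1 (dualGen K)
            ((free (dualSgn (regular K)) 1).act (Equiv.swap 0 2) (dualGen K))
        + plug (free (dualSgn (regular K)) 1) one_add_one_eq_two 2 (dualGen K) (dualGen K)} := by
  rw [forall_totAss_iff]
  constructor
  · intro hx
    obtain ⟨c, rfl⟩ := (Submodule.mem_span_range_iff_exists_fun K).1
      (show x ∈ Submodule.span K (Set.range (alphaTree K)) by rw [span_alphaTree]; trivial)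
    simp only [apply_sum_alphaTree hB] at hx
    have hs : ∀ ρ : Equiv.Perm (Fin 5), sgn K ρ ≠ 0 := fun ρ h => by
      simpa [h] using sgn_mul_self (K := K) ρ
    -- The case `p = 1` reads `c(0,ρ) sgn ρ = c(1,sρ) sgn(sρ)` with `s = (1 3)`, and `sgn(sρ) = -sgn
    -- ρ`.
    have h1 : ∀ ρ, c (1, Equiv.swap 1 3 * ρ) = -c (0, ρ) := fun ρ => by
      have := hx 1 ρ
      simp only [Fin.val_one, Nat.one_mod, pow_one, sgn_swap_mul] at this
      refine mul_right_cancel₀ (hs ρ) ?_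
      rw [neg_mul, this, mul_neg, neg_neg]
    have h2 : ∀ ρ, c (2, ρ) = c (0, ρ) := fun ρ => by
      have := hx 2 ρ
      simp only [Fin.val_two, Nat.mod_self, pow_zero, one_mul] at this
      exact (mul_right_cancel₀ (hs ρ) this).symm
    -- Reindexing the middle sum by `ρ ↦ (1 3)ρ` makes `c(0,ρ)` a common factor of the three terms.
    have h3 : ∑ p, c p • alphaTree K p = ∑ ρ, c (0, ρ) •
        (alphaTree K (0, ρ) - alphaTree K (1, Equiv.swap 1 3 * ρ) + alphaTree K (2, ρ)) := by
      rw [Fintype.sum_prod_type, Fin.sum_univ_three, ← Equiv.sum_comp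
        (Equiv.mulLeft (Equiv.swap 1 3)) fun ρ => c (1, ρ) • alphaTree K (1, ρ)]
      simp only [Equiv.coe_mulLeft, h1, h2, smul_add, smul_neg, neg_smul,
        Finset.sum_add_distrib, Finset.sum_neg_distrib, sub_eq_add_neg]
    rw [h3]
    refine Submodule.sum_mem _ fun ρ _ => Submodule.smul_mem _ _ ?_
    rw [← act_partAssRel]
    exact Submodule.subset_span ⟨ρ, _, rfl, rfl⟩
  · intro hx p ρ'
    induction hx using Submodule.span_induction with
    | zero => simp
    | add y z _ _ hy hz => simp only [map_add, LinearMap.add_apply, hy, hz]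
    | smul c y _ hy => simp only [map_smul, LinearMap.smul_apply, hy]
    | mem y hy =>
    obtain ⟨ρ, _, rfl, rfl⟩ := hy
    rw [act_partAssRel]
    simp only [map_add, map_sub, LinearMap.add_apply, LinearMap.sub_apply,
      hB, sgn_swap_mul]
    -- Pulling the sign out of the conditional makes the two minus signs of the middle term cancel,
    -- so all three shapes give the same value.
    have hneg : ∀ (q : Prop) [Decidable q] (a : K),
        (if q then -a else 0) = -if q then a else 0 := fun q _ a => by
      split_ifs <;> simp
    fin_cases p <;> simp [hneg]

end Orthogonal

-- The diagonality hypothesis of `forall_totAss_iff_mem` for the actual pairing. Characteristic `0`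
-- enters here, through the average over twelve planar forms in its definition.
set_option maxRecDepth 10000 in
theorem koszulPairing_alphaTree_muTree [CharZero K] (p q : Fin 3 × Equiv.Perm (Fin 5)) :
    koszulPairing (regular K) (alphaTree K p) (muTree K q) = if p = q then sgn K p.2 else 0 := by
  refine Eq.trans ?_ (if_congr Prod.ext_iff.symm rfl rfl)
  exact koszulPairing_alpha_mu p.1 q.1 p.2 q.2

-- Unfolding `tau13Ass` identifies `alpha` with `dualGen` and membership in the annihilator with the
-- left side of `forall_totAss_iff_mem`.
set_option maxRecDepth 10000 in
theorem dualRelations_tau13Ass [CharZero K] :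
    (tau13Ass K).dualRelations =
      symSpan (tau13Ass K).dualFree
        {plug (tau13Ass K).dualFree one_add_one_eq_two 0 (alpha K) (alpha K)
          - plug (tau13Ass K).dualFree one_add_one_eq_two 1 (alpha K)
              ((tau13Ass K).dualFree.act (Equiv.swap 0 2) (alpha K))
          + plug (tau13Ass K).dualFree one_add_one_eq_two 2 (alpha K) (alpha K)} :=
  Submodule.ext fun x => forall_totAss_iff_mem (koszulPairing_alphaTree_muTree K) x

end Relations

end TernaryOperad

/-! ### The dual relations and the isomorphism of operads -/

open TernaryOperad in
theorem mainTheorem6 (K : Type*) [Field K] [CharZero K] :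
    (tau13Ass K).dualRelations =
        symSpan (tau13Ass K).dualFree
          {plug (tau13Ass K).dualFree one_add_one_eq_two 0 (alpha K) (alpha K)
            - plug (tau13Ass K).dualFree one_add_one_eq_two 1 (alpha K)
                ((tau13Ass K).dualFree.act (Equiv.swap 0 2) (alpha K))
            + plug (tau13Ass K).dualFree one_add_one_eq_two 2 (alpha K) (alpha K)} ∧
      ∃ f : (tau13Ass K).dualOperad.Hom (tau13PassOne K),
        f.IsIso ∧ f.toFun (quotientMk _ _ (alpha K)) = tau13PassOneGen K := by
  refine ⟨dualRelations_tau13Ass K, ?_⟩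
  let F : (tau13Ass K).dualFree.Hom (free (regular K) 1) := freeMap 1 (ofDual K) (ofDual_act K)
  let G : (free (regular K) 1).Hom (tau13Ass K).dualFree := freeMap 1 (toDual K) (toDual_act K)
  have hF : F.toFun (alpha K) = freeGen (regular K) 1 (regularGen K) := by
    rw [← ofDual_regularDualGen]; rfl
  have hG : G.toFun (freeGen (regular K) 1 (regularGen K)) = alpha K := by
    rw [alpha, ← toDual_regularGen]; rfl
  have hFR : ∀ x ∈ ((tau13Ass K).dualRelations : Set ((tau13Ass K).dualFree.obj 5 2)),
      IdealMem (free (regular K) 1) {partAssRel (free (regular K) 1) one_add_one_eq_two tau13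
        (freeGen (regular K) 1 (regularGen K))} 5 2 (F.toFun x) := by
    intro x hx
    rw [SetLike.mem_coe, dualRelations_tau13Ass] at hx
    -- All of `R^⊥` lies in the ideal of its one generator, so only the image of that generator
    -- under `F` has to be checked; it is the partial associativity relation itself.
    refine IdealMem.map F ?_ (symSpan_le_idealMem _ _ hx)
    rintro _ rfl
    refine .of _ ?_
    rw [Set.mem_singleton_iff, partAssRel_tau13, map_add, map_sub, F.map_plug, F.map_plug,
      F.map_plug, F.map_act, hF]
  have hGR : ∀ x ∈ ({partAssRel (free (regular K) 1) one_add_one_eq_two tau13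
      (freeGen (regular K) 1 (regularGen K))} : Set ((free (regular K) 1).obj 5 2)),
      IdealMem (tau13Ass K).dualFree
        ((tau13Ass K).dualRelations : Set ((tau13Ass K).dualFree.obj 5 2)) 5 2 (G.toFun x) := by
    rintro _ rfl
    refine .of _ ?_
    rw [SetLike.mem_coe, dualRelations_tau13Ass, partAssRel_tau13, map_add, map_sub, G.map_plug,
      G.map_plug, G.map_plug, G.map_act, hG]
    exact mem_symSpan _ rfl
  refine ⟨quotientMap F _ _ hFR, quotientMap_isIso F G _ _ hFR hGR
    (freeMap_leftInverse 1 _ _ _ _ (toDual_ofDual K))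
    (freeMap_leftInverse 1 _ _ _ _ (ofDual_toDual K)), ?_⟩
  -- The induced morphism sends the class of `α` to the class of `F α` by definition.
  exact congrArg (quotientMk _ _) hF
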